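/- Let $F=\mathbb{Q}(\alpha)$ and let $\Lambda_F=F[p_1,p_2,\dots]$ be the ring of symmetric functions over $F$ in $x_1,x_2,\dots$, where $p_k=\sum_i x_i^k$. Write $m_\lambda$ for the monomial symmetric functions, $p_\lambda=p_{\lambda_1}p_{\lambda_2}\cdots$, $l(\lambda)$ for the number of nonzero parts of $\lambda$, $m_k(\lambda)$ for the multiplicity of $k$ in $\lambda$, $z_\lambda=\prod_{k\ge1}k^{m_k(\lambda)}m_k(\lambda)!$, and $\ge$ for the dominance order on partitions of a fixed weight. Let $\langle p_\lambda,p_\mu\rangle=\delta_{\lambda\mu}\,\alpha^{l(\lambda)}z_\lambda$ be the Jack scalar product. Consider families $(P_\lambda)$ in $\Lambda_F$, indexed by all partitions, such that $P_\lambda=m_\lambda+\sum_{\mu<\lambda}c_{\lambda\mu}m_\mu$ with $c_{\lambda\mu}\in F$, and $\langle P_\lambda,P_\mu\rangle=0$ whenever $\mu<\lambda$ (in particular, any such unitriangular family with $\langle P_\lambda,P_\mu\rangle=0$ for all $\lambda\ne\mu$ is of this kind). There is exactly one such family, the Jack symmetric functions $P_\lambda(\alpha)$, and there is exactly one dual family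 $Q_\lambda(\alpha)$, defined by $\langle Q_\lambda(\alpha),P_\mu(\alpha)\rangle=\delta_{\lambda\mu}$ for all partitions $\lambda,\mu$. Put $q_{(n)}=\sum_{\lambda\vdash n}\alpha^{-l(\lambda)}z_\lambda^{-1}p_\lambda$, $q_\lambda=q_{(\lambda_1)}q_{(\lambda_2)}\cdots$, and $e'_\lambda=\frac12\alpha\sum_i\lambda_i^2-\sum_i i\lambda_i$. For a partition $\lambda=(\lambda_1\ge\lambda_2\ge\cdots)$, indices $i<j$ and an integer $k$ with $0<k\le\lambda_j$, call $r^i_j(k)$ a moving up operator for $\lambda$, and let $r^i_j(k).\lambda$ be the partition obtained from $(\lambda_1,\dots,\lambda_i+k,\dots,\lambda_j-k,\dots)$ by rearranging the parts in decreasing order. Then for every partition $\lambda$, $$Q_\lambda(\alpha)=\sum_{(r_l,\dots,r_2,r_1)}\ \prod_{t=1}^{l}\frac{(r_{t-1}\cdots r_1.\lambda)_{i_t}-(r_{t-1}\cdots r_1.\lambda)_{j_t}+2k_t}{e'_\lambda-e'_{r_t\cdots r_1.\lambda}}\ q_{r_l\cdots r_2r_1.\lambda},$$ where the sum is over all sequences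 $(r_l,\dots,r_1)$, $l\ge0$, in which each $r_t=r^{i_t}_{j_t}(k_t)$ is a moving up operator for $r_{t-1}\cdots r_1.\lambda$; operators are distinguished by their labels $(i_t,j_t,k_t)$, and $l=0$ gives the term $q_\lambda$. For each $\lambda$ there are only finitely many such sequences, and all denominators are nonzero. -/

import Mathlib

noncomputable section

namespace Jack

open scoped Nat

/-! ### Partitions, rows, dominance -/

/-- `row lam i` is the `i`-th row of `lam`, counted from `0`, in decreasing order
(so it is the part `λ_{i+1}`), and `0` beyond the length of `lam`. -/
def row {n : ℕ} (lam : n.Partition) (i : ℕ) : ℕ :=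
  (lam.parts.sort (· ≥ ·)).getD i 0

/-- The number of nonzero parts. -/
def length {n : ℕ} (lam : n.Partition) : ℕ := Multiset.card lam.parts

/-- Dominance order: `DomLE mu lam` means `mu ≤ lam`. -/
def DomLE {n : ℕ} (mu lam : n.Partition) : Prop :=
  ∀ i : ℕ, ∑ x ∈ Finset.range i, row mu x ≤ ∑ x ∈ Finset.range i, row lam x

/-- Strict dominance order. -/
def DomLT {n : ℕ} (mu lam : n.Partition) : Prop := DomLE mu lam ∧ mu ≠ lam

/-- A partition together with its weight. -/
abbrev Ptn : Type := Σ n : ℕ, n.Partition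

/-! ### The ring of symmetric functions -/

/-- The field `ℚ(α)`. -/
abbrev F : Type := RatFunc ℚ

/-- The indeterminate `α`. -/
def alpha : F := RatFunc.X

/-- The ring `Λ_F` of symmetric functions over `F = ℚ(α)`, as the polynomial ring
`F[p₁, p₂, …]` in the power sums; the variable with index `k` is `p_k`. -/
abbrev SymF : Type := MvPolynomial ℕ+ F

open Classical in
/-- The power sum `∑ i, x_i ^ k` as a formal power series in `x₀, x₁, x₂, …`. -/
def powerSumSeries (k : ℕ+) : MvPowerSeries ℕ F :=
  fun d => if ∃ i : ℕ, d = Finsupp.single i (k : ℕ) then 1 else 0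

/-- A symmetric function as a formal power series in the variables `x₀, x₁, x₂, …`. -/
def realize : SymF →ₐ[F] MvPowerSeries ℕ F := MvPolynomial.aeval powerSumSeries

/-- The monomial symmetric function `m_mu`: the sum of all distinct monomials in
`x₀, x₁, x₂, …` whose nonzero exponents are, up to order, the parts of `mu`. -/
def monomialSeries {n : ℕ} (mu : n.Partition) : MvPowerSeries ℕ F :=
  fun d => if d.support.val.map d = mu.parts then 1 else 0

/-- The exponent vector of `p_lam = p_{λ₁} p_{λ₂} ⋯`: it sends `k` to the multiplicity
`m_k(lam)` of the part `k`. -/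
def expo {n : ℕ} (lam : n.Partition) : ℕ+ →₀ ℕ :=
  Multiset.toFinsupp (lam.parts.map Nat.toPNat')

/-- For the exponent vector `d` of `p_lam` this is `α ^ l(lam) * z_lam`, where
`z_lam = ∏ k, k ^ m_k * m_k !`. -/
def weight (d : ℕ+ →₀ ℕ) : F :=
  d.prod fun k m => alpha ^ m * (((k : ℕ) ^ m * m ! : ℕ) : F)

/-- The Jack scalar product: the bilinear form with
`⟨p_lam, p_mu⟩ = δ_{lam, mu} α ^ l(lam) z_lam`. -/
def form (f g : SymF) : F :=
  ∑ d ∈ f.support, MvPolynomial.coeff d f * MvPolynomial.coeff d g * weight d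

/-! ### Generalized homogeneous functions -/

/-- `Q_n = ∑ α ^ (-l(lam)) z_lam⁻¹ p_lam`, over all partitions `lam` of `n`. -/
def oneRow (n : ℕ) : SymF :=
  ∑ lam : n.Partition, MvPolynomial.monomial (expo lam) (weight (expo lam))⁻¹

/-- `q_lam = Q_{λ₁} Q_{λ₂} ⋯`. -/
def q {n : ℕ} (lam : n.Partition) : SymF := (lam.parts.map oneRow).prod

/-! ### Jack functions -/

/-- `f = m_lam + ∑ c_mu m_mu`, the sum being over partitions `mu < lam` in the dominance
order, with coefficients in `ℚ(α)`. -/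
def IsUnitriangular {n : ℕ} (lam : n.Partition) (f : SymF) : Prop :=
  ∃ c : n.Partition → F, c lam = 1 ∧ (∀ mu, c mu ≠ 0 → DomLE mu lam) ∧
    realize f = ∑ mu : n.Partition, c mu • monomialSeries mu

/-- `P` is the family of Jack functions `P_lam`: each `P_lam` is unitriangular in the
monomial symmetric functions and `⟨P_lam, P_mu⟩ = 0` for `mu < lam`.

Orthogonality is required only of comparable partitions, which already determines the family;
a family with `⟨P_lam, P_mu⟩ = 0` for all `lam ≠ mu` satisfies it in particular, see
`isJackFamily_of_pairwise_orthogonal`. -/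
def IsJackFamily (P : Ptn → SymF) : Prop :=
  (∀ (n : ℕ) (lam : n.Partition), IsUnitriangular lam (P ⟨n, lam⟩)) ∧
  ∀ (n : ℕ) (lam mu : n.Partition), DomLT mu lam → form (P ⟨n, lam⟩) (P ⟨n, mu⟩) = 0

theorem isJackFamily_of_pairwise_orthogonal (P : Ptn → SymF)
    (htri : ∀ (n : ℕ) (lam : n.Partition), IsUnitriangular lam (P ⟨n, lam⟩))
    (horth : ∀ lam mu : Ptn, lam ≠ mu → form (P lam) (P mu) = 0) : IsJackFamily P := by
  refine ⟨htri, fun n lam mu h => horth _ _ fun he => h.2 ?_⟩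
  cases he
  rfl

open Classical in
/-- `Q` is the dual family of `P`: `⟨Q_lam, P_mu⟩ = δ_{lam, mu}`. -/
def IsDualFamily (P Q : Ptn → SymF) : Prop :=
  ∀ lam mu : Ptn, form (Q lam) (P mu) = if lam = mu then 1 else 0

/-! ### Moving up operators -/

/-- `e'_lam = (1/2) α ∑ i, λ_i ^ 2 - ∑ i, i λ_i`, where `i` starts from `1`. -/
def ePrime {n : ℕ} (lam : n.Partition) : F :=
  (1 / 2) * alpha * ∑ x ∈ Finset.range (length lam), (row lam x : F) ^ 2
    - ∑ x ∈ Finset.range (length lam), ((x + 1 : ℕ) : F) * (row lam x : F)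

/-- The label of an operator `r_j^i(k)`; the rows `i`, `j` are counted from `0`. -/
structure Move where
  i : ℕ
  j : ℕ
  k : ℕ

/-- `r_j^i(k)` is a moving up operator for `lam`: `i < j` and `λ_j ≥ k > 0`. -/
def IsMove {n : ℕ} (lam : n.Partition) (r : Move) : Prop :=
  r.i < r.j ∧ 0 < r.k ∧ r.k ≤ row lam r.j

/-- The rows `(λ_1, …, λ_i + k, …, λ_j - k, …, λ_s)`. -/
def movedRow {n : ℕ} (lam : n.Partition) (r : Move) (x : ℕ) : ℕ :=
  if x = r.i then row lam x + r.k else if x = r.j then row lam x - r.k else row lam x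

theorem sum_row {n : ℕ} (lam : n.Partition) :
    ∑ x ∈ Finset.range (length lam), row lam x = n := by
  have h : (lam.parts.sort (· ≥ ·)).sum = n := by
    rw [← Multiset.sum_coe, Multiset.sort_eq, lam.parts_sum]
  have hl : length lam = (lam.parts.sort (· ≥ ·)).length := by simp [length]
  rw [hl]
  conv_rhs => rw [← h, ← Fin.sum_univ_getElem]
  rw [Finset.sum_range]
  refine Finset.sum_congr rfl fun x _ => ?_
  exact List.getD_eq_getElem _ _ x.2

theorem sum_movedRow {n : ℕ} (lam : n.Partition) (r : Move) (h : IsMove lam r) :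
    ((Multiset.range (length lam)).map (movedRow lam r)).sum = n := by
  obtain ⟨hij, hk, hkj⟩ := h
  have hj : r.j < length lam := by
    by_contra hc
    have : row lam r.j = 0 := by
      have hl : (lam.parts.sort (· ≥ ·)).length ≤ r.j := by
        simpa [length] using not_lt.mp hc
      simp [row, List.getElem?_eq_none hl]
    omega
  have key : ∑ x ∈ Finset.range (length lam), (movedRow lam r x + if x = r.j then r.k else 0)
      = ∑ x ∈ Finset.range (length lam), (row lam x + if x = r.i then r.k else 0) := by
    refine Finset.sum_congr rfl fun x _ => ?_
    unfold movedRow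
    by_cases h1 : x = r.i
    · have : x ≠ r.j := by omega
      simp [h1, show r.i ≠ r.j by omega]
    · by_cases h2 : x = r.j
      · subst h2
        simp only [h1, if_false, if_true]
        omega
      · simp [h1, h2]
  rw [Finset.sum_add_distrib, Finset.sum_add_distrib, sum_row] at key
  have hi : r.i < length lam := by omega
  simp only [Finset.sum_ite_eq', Finset.mem_range, hi, hj, if_true] at key
  have : ((Multiset.range (length lam)).map (movedRow lam r)).sum
      = ∑ x ∈ Finset.range (length lam), movedRow lam r x := rfl
  omega

open Classical in
/-- The partition `r_j^i(k).lam`: move `k` squares from row `j` to row `i` and rearrange the rows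
(the value is `lam` when `r` is not a moving up operator for `lam`; this is never used). -/
def moveUp {n : ℕ} (lam : n.Partition) (r : Move) : n.Partition :=
  if h : IsMove lam r then
    Nat.Partition.ofSums n ((Multiset.range (length lam)).map (movedRow lam r))
      (sum_movedRow lam r h)
  else lam

/-- The list `[r₁, r₂, …, r_l]` is a sequence of moving up operators starting from `lam`: `r_t`
is a moving up operator for `r_{t-1} ⋯ r₁.lam`, for each `t`. -/
def IsMoveSeq {n : ℕ} : n.Partition → List Move → Prop
  | _, [] => True
  | lam, r :: rs => IsMove lam r ∧ IsMoveSeq (moveUp lam r) rs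

/-- `r_l ⋯ r₂ r₁.lam` for the list `[r₁, r₂, …, r_l]`. -/
def applySeq {n : ℕ} (lam : n.Partition) (rs : List Move) : n.Partition :=
  rs.foldl moveUp lam

/-- The coefficient attached to the sequence `[r₁, …, r_l]`: the product over `t = 1, …, l` of
`((cur)_i - (cur)_j + 2 k) / (e'_lam - e'_{r_t.cur})`,
where `cur = r_{t-1} ⋯ r₁.lam` and `r_t = r_j^i(k)`. -/
def seqCoeff {n : ℕ} (lam : n.Partition) (rs : List Move) : F :=
  ∏ t : Fin rs.length,
    ((row (applySeq lam (rs.take t)) rs[t].i : F) - (row (applySeq lam (rs.take t)) rs[t].j : F)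
        + 2 * (rs[t].k : F))
      / (ePrime lam - ePrime (applySeq lam (rs.take (t + 1))))

end Jack

end

noncomputable section

namespace Jack

open MvPolynomial
open scoped Nat

/-! ### The weights and the scalar product -/

/-! The sum over sequences is an eigenvector of the Laplace–Beltrami operator. Let `p_k^⊥ = α k
∂/∂p_k`, the adjoint of multiplication by `p_k`, and let `D = (1/2α) ∑ (p_{i+j} p_i^⊥ p_j^⊥ + p_i
p_j p_{i+j}^⊥) + ((α-1)/2α) ∑ i p_i p_i^⊥`. It is self-adjoint and of second order, so on a product
`q_λ` it acts factor by factor, plus one interaction term for each pair of factors. From `p_k^⊥ q_n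
= q_{n-k}` and `∑ p_k q_{n-k} = α n q_n` one gets (`lap_q`, `gam_q`, `lapF_q`) `D q_λ = (e'_λ + n/2)
q_λ + ∑_r (λ_i - λ_j + 2k) q_{r.λ}`, over the moving up operators `r`.

The eigenvector equation with leading term `q_λ` is thus a triangular recursion, solved by summing
over paths (`lapF_jackQ`). The denominators do not vanish because a move strictly raises `∑ λ_i^2`,
which is twice the coefficient of `α` in `e'`.

Moves go up in the dominance order, so these eigenvectors `jackQ` are unitriangular in the `q_μ`.
The `q_μ` are dual to the `m_μ` (`formL_qExp`), so the basis `jackP` dual to `jackQ` is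
unitriangular downwards in the `m_μ`. Self-adjointness of `D` makes `jackP` orthogonal on comparable
partitions, whose eigenvalues differ. Conversely, the difference of two families with these
properties is, by induction, orthogonal to itself, and the form is anisotropic
(`eq_zero_of_formL_self`); so the family is unique, and so is its dual. -/

theorem alpha_ne_zero : alpha ≠ 0 := RatFunc.X_ne_zero

theorem weight_ne_zero (d : ℕ+ →₀ ℕ) : weight d ≠ 0 := by
  unfold weight
  refine Finset.prod_ne_zero_iff.2 fun k _ => mul_ne_zero (pow_ne_zero _ alpha_ne_zero) ?_
  exact Nat.cast_ne_zero.2 (mul_ne_zero (pow_ne_zero _ k.ne_zero) (Nat.factorial_ne_zero _))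

theorem weight_add_single (d : ℕ+ →₀ ℕ) (k : ℕ+) :
    weight (d + Finsupp.single k 1) = alpha * (k : ℕ) * (d k + 1) * weight d := by
  unfold weight
  set h : ℕ+ → ℕ → F := fun k m => alpha ^ m * (((k : ℕ) ^ m * m ! : ℕ) : F) with hh
  have h0 : ∀ k, h k 0 = 1 := fun k => by simp [hh]
  rw [← Finsupp.mul_prod_erase' d k h h0,
    ← Finsupp.mul_prod_erase' (d + Finsupp.single k 1) k h h0]
  have : (d + Finsupp.single k 1).erase k = d.erase k := by
    rw [Finsupp.erase_add]; simp
  rw [this]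
  simp only [hh, Finsupp.add_apply, Finsupp.single_eq_same, Nat.factorial_succ]
  push_cast
  ring

/-- The Jack scalar product as a bilinear map. -/
def formL : SymF →ₗ[F] SymF →ₗ[F] F :=
  (basisMonomials ℕ+ F).constr F fun d => weight d • lcoeff F d

theorem formL_monomial_left (d : ℕ+ →₀ ℕ) (a : F) (g : SymF) :
    formL (monomial d a) g = a * coeff d g * weight d := by
  have : monomial d a = a • (basisMonomials ℕ+ F) d := by
    simp [smul_monomial]
  rw [this, map_smul, formL, Module.Basis.constr_basis]
  simp [lcoeff]
  ring

theorem form_eq (f g : SymF) : form f g = formL f g := by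
  conv_rhs => rw [f.as_sum]
  rw [map_sum, LinearMap.sum_apply]
  exact Finset.sum_congr rfl fun d _ => (formL_monomial_left _ _ _).symm

theorem formL_comm (f g : SymF) : formL f g = formL g f := by
  induction f using MvPolynomial.induction_on' with
  | monomial d a =>
    induction g using MvPolynomial.induction_on' with
    | monomial e b =>
      simp only [formL_monomial_left, coeff_monomial]
      by_cases h : d = e
      · subst h; simp [mul_comm]
      · simp [h, Ne.symm h]
    | add p q hp hq => simp only [map_add, LinearMap.add_apply, hp, hq]
  | add p q hp hq => simp only [map_add, LinearMap.add_apply, hp, hq]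

theorem eq_zero_of_formL_monomial (f : SymF) (h : ∀ d, formL (monomial d 1) f = 0) : f = 0 := by
  ext d
  have := h d
  rw [formL_monomial_left, one_mul] at this
  simpa [weight_ne_zero] using this

/-- The weight of `d` as a polynomial in `α`. -/
def weightPoly (d : ℕ+ →₀ ℕ) : Polynomial ℚ :=
  d.prod fun k m => Polynomial.X ^ m * (((k : ℕ) ^ m * m ! : ℕ) : Polynomial ℚ)

theorem algebraMap_weightPoly (d : ℕ+ →₀ ℕ) :
    algebraMap (Polynomial ℚ) F (weightPoly d) = weight d := by
  unfold weightPoly weight Finsupp.prod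
  rw [map_prod]
  refine Finset.prod_congr rfl fun k _ => ?_
  rw [map_mul, map_pow, RatFunc.algebraMap_X, map_natCast]
  rfl

theorem eval_weightPoly_pos (d : ℕ+ →₀ ℕ) {x : ℚ} (hx : 0 < x) : 0 < (weightPoly d).eval x := by
  unfold weightPoly Finsupp.prod
  rw [Polynomial.eval_prod]
  refine Finset.prod_pos fun k _ => ?_
  rw [Polynomial.eval_mul, Polynomial.eval_pow, Polynomial.eval_X, Polynomial.eval_natCast]
  have : 0 < (k : ℕ) ^ d k * (d k)! := Nat.mul_pos (Nat.pow_pos k.pos) (Nat.factorial_pos _)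
  have : (0 : ℚ) < ((k : ℕ) ^ d k * (d k)! : ℕ) := by exact_mod_cast this
  positivity

/-- After clearing denominators, specialise `α` to a positive rational. The weights become positive,
so a vanishing weighted sum of squares vanishes term by term; each cleared coefficient then has
infinitely many roots. -/
theorem eq_zero_of_formL_self (f : SymF) (h : formL f f = 0) : f = 0 := by
  classical
  obtain ⟨⟨b, hb⟩, hint⟩ := IsLocalization.exist_integer_multiples_of_finset
    (nonZeroDivisors (Polynomial ℚ)) (f.support.image fun d => coeff d f)
  have hint' : ∀ d : ℕ+ →₀ ℕ, ∃ g : Polynomial ℚ,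
      algebraMap (Polynomial ℚ) F g = algebraMap (Polynomial ℚ) F b * coeff d f := by
    intro d
    by_cases hd : d ∈ f.support
    · obtain ⟨g, hg⟩ := hint _ (Finset.mem_image_of_mem _ hd)
      exact ⟨g, by rw [hg, Algebra.smul_def]⟩
    · exact ⟨0, by simp [notMem_support_iff.1 hd]⟩
  choose g hg using hint'
  have hinj : Function.Injective (algebraMap (Polynomial ℚ) F) :=
    IsFractionRing.injective (Polynomial ℚ) F
  have hb0 : algebraMap (Polynomial ℚ) F b ≠ 0 := fun h0 =>
    nonZeroDivisors.ne_zero hb (hinj (by rw [h0, map_zero]))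
  have hsum : ∑ d ∈ f.support, g d ^ 2 * weightPoly d = 0 := by
    apply hinj
    rw [map_sum, map_zero]
    have : ∀ d ∈ f.support, algebraMap (Polynomial ℚ) F (g d ^ 2 * weightPoly d)
        = algebraMap (Polynomial ℚ) F b ^ 2 * (coeff d f * coeff d f * weight d) := by
      intro d _
      rw [map_mul, map_pow, hg, algebraMap_weightPoly]
      ring
    rw [Finset.sum_congr rfl this, ← Finset.mul_sum]
    have h' : ∑ d ∈ f.support, coeff d f * coeff d f * weight d = 0 := by
      rw [← h, ← form_eq]; rfl
    rw [h', mul_zero]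
  ext d
  rw [coeff_zero]
  by_contra hd
  have hroot : g d = 0 := by
    refine Polynomial.eq_zero_of_infinite_isRoot _ (Set.Infinite.mono ?_ (Set.Ioi_infinite (0 : ℚ)))
    intro x hx
    have hev := congrArg (Polynomial.eval x) hsum
    rw [Polynomial.eval_finsetSum, Polynomial.eval_zero, Finset.sum_eq_zero_iff_of_nonneg] at hev
    · have := hev d (mem_support_iff.2 hd)
      rw [Polynomial.eval_mul, Polynomial.eval_pow] at this
      simpa [(eval_weightPoly_pos d hx).ne'] using this
    · intro e _
      rw [Polynomial.eval_mul, Polynomial.eval_pow]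
      exact mul_nonneg (sq_nonneg _) (eval_weightPoly_pos e hx).le
  have := hg d
  rw [hroot, map_zero] at this
  exact (mul_ne_zero hb0 hd) this.symm

/-! ### The adjoint of multiplication by a power sum -/

/-- The adjoint `α k ∂/∂p_k` of multiplication by `p_k`. -/
def perp (k : ℕ+) : Derivation F SymF SymF := (alpha * (k : ℕ)) • pderiv k

theorem coeff_perp (k : ℕ+) (f : SymF) (d : ℕ+ →₀ ℕ) :
    coeff d (perp k f) = alpha * (k : ℕ) * (d k + 1) * coeff (d + Finsupp.single k 1) f := by
  simp only [perp, Derivation.smul_apply, coeff_smul, coeff_pderiv, smul_eq_mul]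
  ring

/-- On monomials, the factor `α k (d_k + 1)` produced by differentiation is exactly the ratio of
weights in `weight_add_single`. -/
theorem formL_X_mul (k : ℕ+) (f g : SymF) : formL (X k * f) g = formL f (perp k g) := by
  induction f using MvPolynomial.induction_on' with
  | monomial d a =>
    rw [X, monomial_mul, one_mul, formL_monomial_left, formL_monomial_left, coeff_perp,
      add_comm (Finsupp.single k 1), weight_add_single]
    ring
  | add p q hp hq => simp only [mul_add, map_add, LinearMap.add_apply, hp, hq]

theorem formL_perp (k : ℕ+) (f g : SymF) : formL (perp k f) g = formL f (X k * g) := by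
  rw [formL_comm, ← formL_X_mul, formL_comm]

/-! ### Degrees and partitions -/

/-- The degree of the monomial `p^d`, where `p_k` has degree `k`. -/
def deg : (ℕ+ →₀ ℕ) →+ ℕ := Finsupp.weight fun k : ℕ+ => (k : ℕ)

theorem deg_single (k : ℕ+) (m : ℕ) : deg (Finsupp.single k m) = m * k := by
  simp [deg, Finsupp.weight_single]

theorem deg_toFinsupp (s : Multiset ℕ+) :
    deg (Multiset.toFinsupp s) = (s.map fun k : ℕ+ => (k : ℕ)).sum := by
  induction s using Multiset.induction_on with
  | empty => simp
  | cons a s ih =>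
    rw [← Multiset.singleton_add, map_add, map_add, ih]
    simp [Multiset.toFinsupp_singleton, deg_single]

theorem deg_expo {n : ℕ} (lam : n.Partition) : deg (expo lam) = n := by
  rw [expo, deg_toFinsupp, Multiset.map_map]
  conv_rhs => rw [← lam.parts_sum]
  congr 1
  conv_rhs => rw [← Multiset.map_id lam.parts]
  refine Multiset.map_congr rfl fun x hx => ?_
  exact PNat.toPNat'_coe (lam.parts_pos hx)

theorem expo_injective (n : ℕ) : Function.Injective (expo : n.Partition → (ℕ+ →₀ ℕ)) := by
  intro lam mu h
  have h' := Multiset.toFinsupp.injective h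
  ext1
  have key : ∀ nu : n.Partition,
      (nu.parts.map Nat.toPNat').map (fun k : ℕ+ => (k : ℕ)) = nu.parts := by
    intro nu
    rw [Multiset.map_map]
    conv_rhs => rw [← Multiset.map_id nu.parts]
    refine Multiset.map_congr rfl fun x hx => ?_
    exact PNat.toPNat'_coe (nu.parts_pos hx)
  rw [← key lam, ← key mu, h']

theorem exists_expo_eq (d : ℕ+ →₀ ℕ) : ∃ lam : (deg d).Partition, expo lam = d := by
  set s := Finsupp.toMultiset d
  have hs : Multiset.toFinsupp s = d := by simp [s]
  refine ⟨⟨s.map fun k : ℕ+ => (k : ℕ), ?_, ?_⟩, ?_⟩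
  · intro i hi
    obtain ⟨k, _, rfl⟩ := Multiset.mem_map.1 hi
    exact k.pos
  · rw [← deg_toFinsupp, hs]
  · rw [expo, Multiset.map_map]
    have : (Nat.toPNat' ∘ fun k : ℕ+ => (k : ℕ)) = id := by
      ext k; simp
    rw [this, Multiset.map_id, hs]

/-! ### One-row functions: adjoints and the Euler identity -/

theorem coeff_oneRow (n : ℕ) (d : ℕ+ →₀ ℕ) :
    coeff d (oneRow n) = if deg d = n then (weight d)⁻¹ else 0 := by
  classical
  rw [oneRow, coeff_sum]
  simp only [coeff_monomial]
  split_ifs with h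
  · subst h
    obtain ⟨lam, hlam⟩ := exists_expo_eq d
    rw [Finset.sum_eq_single lam]
    · rw [if_pos hlam, hlam]
    · intro mu _ hmu
      rw [if_neg fun he => hmu (expo_injective _ (he.trans hlam.symm))]
    · simp
  · refine Finset.sum_eq_zero fun lam _ => if_neg fun he => h ?_
    rw [← he, deg_expo]

theorem oneRow_zero : oneRow 0 = 1 := by
  classical
  ext d
  rw [coeff_oneRow, coeff_one]
  by_cases h : 0 = d
  · subst h
    simp [weight]
  · rw [if_neg h, if_neg]
    intro h0
    obtain ⟨lam, hlam⟩ := exists_expo_eq d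
    apply h
    rw [← hlam]
    generalize deg d = m at *
    subst h0
    simp [expo]

/-- Since `∑ q_n t^n = exp (∑ p_k t^k / (α k))`, the operator `α k ∂/∂p_k` multiplies the generating
function by `t^k`. The proof checks this on coefficients. -/
theorem perp_oneRow (k : ℕ+) (n : ℕ) :
    perp k (oneRow n) = if (k : ℕ) ≤ n then oneRow (n - k) else 0 := by
  ext d
  rw [coeff_perp, coeff_oneRow, map_add, deg_single, one_mul, weight_add_single]
  have hd : (d k + 1 : F) ≠ 0 := by exact_mod_cast Nat.succ_ne_zero (d k)
  have hk : ((k : ℕ) : F) ≠ 0 := by exact_mod_cast k.ne_zero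
  have ha := alpha_ne_zero
  have hw := weight_ne_zero d
  split_ifs with h1 h2 h2
  · rw [coeff_oneRow, if_pos (by omega)]
    field_simp
  · omega
  · rw [coeff_oneRow, if_neg (by omega), mul_zero]
  · simp

theorem coeff_X_mul_perp (k : ℕ+) (f : SymF) (d : ℕ+ →₀ ℕ) :
    coeff d (X k * perp k f) = alpha * (k : ℕ) * d k * coeff d f := by
  classical
  rw [coeff_X_mul']
  split_ifs with h
  · rw [coeff_perp]
    have hk : 1 ≤ d k := Nat.one_le_iff_ne_zero.2 (Finsupp.mem_support_iff.1 h)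
    rw [tsub_add_cancel_of_le (by simpa using hk)]
    simp only [Finsupp.tsub_apply, Finsupp.single_eq_same, Nat.cast_sub hk]
    push_cast
    ring
  · simp [Finsupp.notMem_support_iff.1 h]

theorem sum_range_deg {d : ℕ+ →₀ ℕ} {n : ℕ} (h : deg d = n) :
    ∑ i ∈ Finset.range n, (i + 1) * d i.succPNat = n := by
  conv_rhs => rw [← h]
  have : deg d = ∑ k ∈ d.support, (k : ℕ) * d k := by
    simp [deg, Finsupp.weight_apply, Finsupp.sum, mul_comm]
  rw [this]
  symm
  refine Finset.sum_of_injOn (fun k : ℕ+ => k.natPred)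
    (fun a _ b _ hab => PNat.natPred_injective hab)
    ?_ ?_ ?_
  · intro k hk
    simp only [Finset.coe_range, Set.mem_Iio]
    have h1 : (k : ℕ) * d k ≤ deg d := this ▸ Finset.single_le_sum
      (f := fun k : ℕ+ => (k : ℕ) * d k) (fun _ _ => Nat.zero_le _) hk
    have h2 : 1 ≤ d k := Nat.one_le_iff_ne_zero.2 (Finsupp.mem_support_iff.1 hk)
    have h3 := PNat.natPred_add_one k
    nlinarith
  · intro i _ hi
    have : d i.succPNat = 0 := by
      by_contra hc
      exact hi ⟨i.succPNat, Finsupp.mem_support_iff.2 hc, Nat.natPred_succPNat i⟩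
    rw [this, mul_zero]
  · intro k _
    rw [PNat.succPNat_natPred, PNat.natPred_add_one]

/-- The power sum `p_{i+1}`. -/
def psum (i : ℕ) : SymF := X i.succPNat

theorem perp_succ_oneRow {i n : ℕ} (h : i < n) :
    perp i.succPNat (oneRow n) = oneRow (n - 1 - i) := by
  rw [perp_oneRow, if_pos (by simpa using h)]
  congr 1
  simp
  omega

theorem perp_succ_oneRow_of_le {i n : ℕ} (h : n ≤ i) : perp i.succPNat (oneRow n) = 0 := by
  rw [perp_oneRow, if_neg (by simpa using h)]

/-- Euler's identity: `∑ p_k p_k^⊥` multiplies each monomial by `α` times its degree. As `psum i` is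
`p_{i+1}`, its cofactor has index `n - 1 - i`. -/
theorem sum_psum_mul_oneRow (n : ℕ) :
    ∑ i ∈ Finset.range n, psum i * oneRow (n - 1 - i) = (alpha * n) • oneRow n := by
  have : ∀ i ∈ Finset.range n, psum i * oneRow (n - 1 - i)
      = X i.succPNat * perp i.succPNat (oneRow n) := by
    intro i hi
    rw [perp_succ_oneRow (Finset.mem_range.1 hi), psum]
  rw [Finset.sum_congr rfl this]
  ext d
  simp only [coeff_sum, coeff_X_mul_perp, coeff_smul, smul_eq_mul]
  rw [← Finset.sum_mul]
  by_cases h : deg d = n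
  · congr 1
    have := sum_range_deg h
    conv_rhs => rw [← this]
    rw [Nat.cast_sum, Finset.mul_sum]
    refine Finset.sum_congr rfl fun i _ => ?_
    rw [Nat.succPNat_coe]
    push_cast
    ring
  · rw [coeff_oneRow, if_neg h]
    simp

end Jack
end

noncomputable section

namespace Jack

open MvPolynomial
open scoped Nat

theorem derivation_prod {K A ι : Type*} [CommRing K] [CommRing A] [Algebra K A] [DecidableEq ι]
    (D : Derivation K A A) (s : Finset ι) (f : ι → A) :
    D (∏ i ∈ s, f i) = ∑ i ∈ s, D (f i) * ∏ j ∈ s.erase i, f j := by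
  induction s using Finset.induction_on with
  | empty => simp
  | insert a s ha ih =>
    rw [Finset.prod_insert ha, D.leibniz, ih, Finset.sum_insert ha, Finset.erase_insert ha,
      smul_eq_mul, smul_eq_mul, Finset.mul_sum, add_comm, mul_comm]
    congr 1
    refine Finset.sum_congr rfl fun i hi => ?_
    have hia : i ≠ a := fun h => ha (h ▸ hi)
    rw [Finset.erase_insert_of_ne hia.symm, Finset.prod_insert (by simp [ha])]
    ring

/-! ### The functions `q` are dual to the monomial functions -/

/-- The product of the one-row functions over an exponent vector. -/
def qExp (d : ℕ →₀ ℕ) : SymF := ∏ i ∈ d.support, oneRow (d i)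

theorem qExp_eq {d : ℕ →₀ ℕ} {s : Finset ℕ} (h : d.support ⊆ s) :
    qExp d = ∏ i ∈ s, oneRow (d i) := by
  refine Finset.prod_subset h fun i _ hi => ?_
  rw [Finsupp.notMem_support_iff.1 hi, oneRow_zero]

theorem perp_qExp (k : ℕ+) (d : ℕ →₀ ℕ) :
    perp k (qExp d) = ∑ i ∈ d.support,
      if (k : ℕ) ≤ d i then qExp (d - Finsupp.single i (k : ℕ)) else 0 := by
  rw [qExp, derivation_prod]
  refine Finset.sum_congr rfl fun i hi => ?_
  rw [perp_oneRow]
  split_ifs with h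
  · have hsub : (d - Finsupp.single i (k : ℕ)).support ⊆ d.support := by
      intro j hj
      rw [Finsupp.mem_support_iff, Finsupp.tsub_apply] at hj
      rw [Finsupp.mem_support_iff]
      omega
    rw [qExp_eq hsub, ← Finset.mul_prod_erase _ _ hi]
    congr 1
    · simp
    · refine Finset.prod_congr rfl fun j hj => ?_
      rw [Finsupp.tsub_apply, Finsupp.single_eq_of_ne (Finset.ne_of_mem_erase hj), tsub_zero]
  · rw [zero_mul]

theorem coeff_mul_powerSumSeries (k : ℕ+) (g : MvPowerSeries ℕ F) (d : ℕ →₀ ℕ) :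
    MvPowerSeries.coeff d (g * powerSumSeries k) = ∑ i ∈ d.support,
      if (k : ℕ) ≤ d i then MvPowerSeries.coeff (d - Finsupp.single i (k : ℕ)) g else 0 := by
  classical
  rw [MvPowerSeries.coeff_mul, ← Finset.sum_filter]
  symm
  have hps : ∀ e, MvPowerSeries.coeff e (powerSumSeries k)
      = if ∃ i : ℕ, e = Finsupp.single i (k : ℕ) then 1 else 0 := by
    intro e
    rw [MvPowerSeries.coeff_apply]
    unfold powerSumSeries
    congr
  refine Finset.sum_of_injOn
    (fun i => (d - Finsupp.single i (k : ℕ), Finsupp.single i (k : ℕ))) ?_ ?_ ?_ ?_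
  · intro a _ b _ hab
    have := (Prod.ext_iff.1 hab).2
    exact ((Finsupp.single_eq_single_iff _ _ _ _).1 this).resolve_right
      (fun h => k.ne_zero h.1) |>.1
  · intro i hi
    rw [Finset.mem_coe, Finset.mem_filter] at hi
    rw [Finset.mem_coe, Finset.HasAntidiagonal.mem_antidiagonal]
    exact tsub_add_cancel_of_le (by simpa using hi.2)
  · rintro ⟨a, b⟩ hab hn
    rw [hps, if_neg, mul_zero]
    rintro ⟨i, rfl⟩
    rw [Finset.HasAntidiagonal.mem_antidiagonal] at hab
    apply hn
    have hk := k.pos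
    have hd : d i = a i + k := by rw [← hab]; simp
    refine ⟨i, ?_, ?_⟩
    · rw [Finset.mem_coe, Finset.mem_filter, Finsupp.mem_support_iff]
      omega
    · ext1
      · exact tsub_eq_of_eq_add hab.symm
      · rfl
  · intro i _
    simp only [hps]
    rw [if_pos ⟨i, rfl⟩, mul_one]

/-- Both sides obey the same recursion when `f` is multiplied by `p_k`: applying `p_k^⊥` to the
product of one-row functions and extracting a coefficient of `f p_k` each remove `k` from one
exponent in all possible ways. -/
theorem formL_qExp (d : ℕ →₀ ℕ) (f : SymF) :
    formL (qExp d) f = MvPowerSeries.coeff d (realize f) := by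
  classical
  induction f using MvPolynomial.induction_on generalizing d with
  | C a =>
    rw [formL_comm, ← monomial_zero', formL_monomial_left, monomial_zero']
    have h1 : realize (C a) = MvPowerSeries.C a := MvPolynomial.aeval_C _ _
    rw [h1, MvPowerSeries.coeff_C]
    have h2 : weight 0 = 1 := by simp [weight]
    rw [h2, mul_one, ← constantCoeff_eq, qExp, map_prod]
    split_ifs with h
    · subst h; simp
    · obtain ⟨i, hi⟩ := Finsupp.support_nonempty_iff.2 h
      rw [Finset.prod_eq_zero hi, mul_zero]
      rw [constantCoeff_eq, coeff_oneRow, if_neg]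
      rw [map_zero]
      exact (Finsupp.mem_support_iff.1 hi).symm
  | add p q hp hq => simp only [map_add, hp, hq]
  | mul_X p k ih =>
    have h1 : realize (p * X k) = realize p * powerSumSeries k := by
      rw [map_mul]; congr 1; exact MvPolynomial.aeval_X _ _
    rw [h1, coeff_mul_powerSumSeries, mul_comm, ← formL_perp, perp_qExp, map_sum,
      LinearMap.sum_apply]
    refine Finset.sum_congr rfl fun i _ => ?_
    split_ifs
    · exact ih _
    · simp

end Jack
end

noncomputable section

namespace Jack

/-! ### The Laplace–Beltrami operator

It is built from elements `p i` of an algebra, thought of as the power sums `p_{i+1}`, and from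
derivations `D i`, thought of as the adjoints of multiplication by them. -/

theorem sum_range_of_zero {M : Type*} [AddCommMonoid M] {n N : ℕ} (h : n ≤ N) (f : ℕ → M)
    (hf : ∀ i, n ≤ i → f i = 0) : ∑ i ∈ Finset.range N, f i = ∑ i ∈ Finset.range n, f i := by
  symm
  refine Finset.sum_subset (Finset.range_mono h) fun i _ hi => hf i ?_
  simpa using hi

/-- The composition obtained from `a` by moving `k` squares from row `y` to row `x`. -/
def moveRow (a : ℕ → ℕ) (x y k : ℕ) (z : ℕ) : ℕ :=
  if z = x then a z + k else if z = y then a z - k else a z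

section LaplaceBeltrami

variable {K A : Type*} [Field K] [CommRing A] [Algebra K A] (α : K) (p : ℕ → A)
  (D : ℕ → Derivation K A A)

/-- The Laplace–Beltrami operator, truncated so that it is right on power sums `p_k`
with `k ≤ N`. -/
def lap (N : ℕ) : A →ₗ[K] A :=
  (2 * α)⁻¹ • ∑ i ∈ Finset.range N, ∑ j ∈ Finset.range N,
    (LinearMap.mulLeft K (p (i + j + 1)) ∘ₗ (D i).toLinearMap ∘ₗ (D j).toLinearMap
      + LinearMap.mulLeft K (p i * p j) ∘ₗ (D (i + j + 1)).toLinearMap)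
  + ((α - 1) / (2 * α)) • ∑ i ∈ Finset.range N,
    ((i + 1 : ℕ) : K) • (LinearMap.mulLeft K (p i) ∘ₗ (D i).toLinearMap)

theorem lap_apply (N : ℕ) (f : A) : lap α p D N f =
    (2 * α)⁻¹ • ∑ i ∈ Finset.range N, ∑ j ∈ Finset.range N,
      (p (i + j + 1) * D i (D j f) + p i * p j * D (i + j + 1) f)
    + ((α - 1) / (2 * α)) • ∑ i ∈ Finset.range N,
      ((i + 1 : ℕ) : K) • (p i * D i f) := by
  simp only [lap, LinearMap.add_apply, LinearMap.smul_apply, LinearMap.sum_apply,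
    LinearMap.comp_apply, LinearMap.mulLeft_apply, Derivation.coeFn_coe]

/-- The two cubic terms are adjoint to each other, up to exchanging `i` and `j`, and each `p_i
p_i^⊥` is its own adjoint. -/
theorem lap_selfAdjoint (B : A →ₗ[K] A →ₗ[K] K) (hp : ∀ i f g, B (p i * f) g = B f (D i g))
    (hD : ∀ i f g, B (D i f) g = B f (p i * g)) (N : ℕ) (f g : A) :
    B (lap α p D N f) g = B f (lap α p D N g) := by
  simp only [lap_apply, map_add, map_smul, map_sum, LinearMap.add_apply, LinearMap.smul_apply,
    LinearMap.sum_apply, hp, mul_assoc, hD, smul_add, Finset.sum_add_distrib]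
  congr 1
  rw [add_comm]
  congr 2
  · rw [Finset.sum_comm]
    refine Finset.sum_congr rfl fun i _ => Finset.sum_congr rfl fun j _ => ?_
    rw [add_comm j i]
  · refine Finset.sum_congr rfl fun i _ => Finset.sum_congr rfl fun j _ => ?_
    rw [mul_left_comm]

/-- The bidifferential part of the Laplace–Beltrami operator. -/
def gam (N : ℕ) (f g : A) : A :=
  α⁻¹ • ∑ i ∈ Finset.range N, ∑ j ∈ Finset.range N, p (i + j + 1) * (D i f * D j g)

/-- Only the second-order term violates the Leibniz rule. Its defect has two halves, equal by the
symmetry in `i` and `j`, which turns `1/(2α)` into `1/α`. -/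
theorem lap_mul [CharZero K] (N : ℕ) (f g : A) :
    lap α p D N (f * g) = lap α p D N f * g + f * lap α p D N g + gam α p D N f g := by
  have hg : gam α p D N f g = (2 * α)⁻¹ • ∑ i ∈ Finset.range N, ∑ j ∈ Finset.range N,
      p (i + j + 1) * (D i f * D j g + D j f * D i g) := by
    have : ∑ i ∈ Finset.range N, ∑ j ∈ Finset.range N, p (i + j + 1) * (D j f * D i g)
        = ∑ i ∈ Finset.range N, ∑ j ∈ Finset.range N, p (i + j + 1) * (D i f * D j g) := by
      rw [Finset.sum_comm]
      refine Finset.sum_congr rfl fun i _ => Finset.sum_congr rfl fun j _ => ?_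
      rw [add_comm j i]
    simp only [mul_add, Finset.sum_add_distrib, this]
    rw [← two_smul K (∑ i ∈ Finset.range N, _), smul_smul, gam]
    congr 1
    field_simp
  rw [hg]
  simp only [lap_apply, add_mul, mul_add, smul_mul_assoc, mul_smul_comm, Finset.sum_mul,
    Finset.mul_sum]
  have : ∀ a b c d e x y : A, a = b + c + e → d = x + y → a + d = b + x + (c + y) + e := by
    intro a b c d e x y h1 h2
    rw [h1, h2]; ring
  apply this
  · rw [← smul_add, ← smul_add]
    congr 1
    simp only [← Finset.sum_add_distrib]
    refine Finset.sum_congr rfl fun i _ => Finset.sum_congr rfl fun j _ => ?_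
    simp only [Derivation.leibniz, map_add, smul_eq_mul]
    ring
  · rw [← smul_add, ← Finset.sum_add_distrib]
    congr 1
    refine Finset.sum_congr rfl fun i _ => ?_
    rw [← smul_add]
    congr 1
    simp only [Derivation.leibniz, smul_eq_mul]
    ring

/-- `gam` is a derivation in its first argument, so factors interact only in pairs. -/
theorem gam_prod_left {ι : Type*} [DecidableEq ι] (N : ℕ) (s : Finset ι) (f : ι → A) (g : A) :
    gam α p D N (∏ i ∈ s, f i) g = ∑ x ∈ s, gam α p D N (f x) g * ∏ j ∈ s.erase x, f j := by
  simp only [gam, derivation_prod, smul_mul_assoc, Finset.sum_mul, Finset.mul_sum,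
    ← Finset.smul_sum]
  congr 1
  rw [Finset.sum_comm]
  conv_rhs => rw [Finset.sum_comm, Finset.sum_congr rfl fun _ _ => Finset.sum_comm, Finset.sum_comm]
  refine Finset.sum_congr rfl fun i _ => Finset.sum_congr rfl fun j _ =>
    Finset.sum_congr rfl fun x _ => ?_
  ring

/-- Each `k < n` is `i + j + 1` in exactly `k` ways. -/
theorem sum_range_sum_range_add (g : ℕ → A) (n : ℕ) :
    ∑ i ∈ Finset.range n, ∑ j ∈ Finset.range (n - 1 - i), g (i + j + 1)
      = ∑ k ∈ Finset.range n, (k : K) • g k := by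
  induction n with
  | zero => simp
  | succ n ih =>
    rw [Finset.sum_range_succ, Finset.sum_range_succ, ← ih]
    have : ∀ i ∈ Finset.range n, ∑ j ∈ Finset.range (n + 1 - 1 - i), g (i + j + 1)
        = ∑ j ∈ Finset.range (n - 1 - i), g (i + j + 1) + g n := by
      intro i hi
      rw [Finset.mem_range] at hi
      rw [show n + 1 - 1 - i = (n - 1 - i) + 1 by omega, Finset.sum_range_succ]
      congr 2
      omega
    rw [Finset.sum_congr rfl this, Finset.sum_add_distrib]
    simp [Nat.cast_smul_eq_nsmul]

/-! ### Action on products of one-row functions -/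

variable {α p D} {q : ℕ → A}

/-- Lowering the index twice is lowering it once by the total, so on one-row functions the
second-order terms become first-order. -/
theorem D_D_q (hDq : ∀ i n, D i (q n) = if i < n then q (n - 1 - i) else 0)
    (i j n : ℕ) : D i (D j (q n)) = D (i + j + 1) (q n) := by
  rw [hDq j n, hDq (i + j + 1) n]
  split_ifs with h1 h2 h2
  · rw [hDq, if_pos (by omega)]
    congr 1; omega
  · rw [hDq, if_neg (by omega)]
  · omega
  · exact map_zero _

theorem sum_sum_D_q (hDq : ∀ i n, D i (q n) = if i < n then q (n - 1 - i) else 0)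
    {n N : ℕ} (h : n ≤ N) (c : ℕ → ℕ → A) :
    ∑ i ∈ Finset.range N, ∑ j ∈ Finset.range N, c i j * D (i + j + 1) (q n)
      = ∑ i ∈ Finset.range n, ∑ j ∈ Finset.range (n - 1 - i), c i j * q (n - 1 - i - 1 - j) := by
  rw [sum_range_of_zero h]
  · refine Finset.sum_congr rfl fun i hi => ?_
    rw [Finset.mem_range] at hi
    rw [sum_range_of_zero (show n - 1 - i ≤ N by omega)]
    · refine Finset.sum_congr rfl fun j hj => ?_
      rw [Finset.mem_range] at hj
      rw [hDq, if_pos (by omega)]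
      congr 2; omega
    · intro j hj
      rw [hDq, if_neg (by omega), mul_zero]
  · intro i hi
    refine Finset.sum_eq_zero fun j _ => ?_
    rw [hDq, if_neg (by omega), mul_zero]

/-- In terms of `T = ∑ k p_k q_{n-k}`, the three sums in `lap` are `T - α n q_n`, `α² n² q_n - α T`
and `T`; the coefficient `α - 1` of the last is what makes `T` cancel. -/
theorem lap_q [CharZero K] (hDq : ∀ i n, D i (q n) = if i < n then q (n - 1 - i) else 0)
    (hpq : ∀ n : ℕ, ∑ i ∈ Finset.range n, p i * q (n - 1 - i) = (α * n) • q n)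
    (hα : α ≠ 0) {n N : ℕ} (h : n ≤ N) :
    lap α p D N (q n) = ((α * (n : K) ^ 2 - n) / 2) • q n := by
  set T := ∑ i ∈ Finset.range n, ((i + 1 : ℕ) : K) • (p i * q (n - 1 - i)) with hT
  have h3 : ∑ i ∈ Finset.range N, ((i + 1 : ℕ) : K) • (p i * D i (q n)) = T := by
    rw [sum_range_of_zero h]
    · refine Finset.sum_congr rfl fun i hi => ?_
      rw [hDq, if_pos (Finset.mem_range.1 hi)]
    · intro i hi
      rw [hDq, if_neg (by omega), mul_zero, smul_zero]
  have h1 : ∑ i ∈ Finset.range N, ∑ j ∈ Finset.range N,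
      p (i + j + 1) * D (i + j + 1) (q n) = T - (α * n) • q n := by
    rw [sum_sum_D_q hDq h]
    have := sum_range_sum_range_add (K := K) (fun k => p k * q (n - 1 - k)) n
    rw [← hpq, hT, ← Finset.sum_sub_distrib]
    refine Eq.trans ?_ (this.trans ?_)
    · refine Finset.sum_congr rfl fun i _ => Finset.sum_congr rfl fun j _ => ?_
      congr 2
      omega
    · refine Finset.sum_congr rfl fun i _ => ?_
      rw [Nat.cast_succ, add_smul, one_smul, add_sub_cancel_right]
  have h2 : ∑ i ∈ Finset.range N, ∑ j ∈ Finset.range N,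
      p i * p j * D (i + j + 1) (q n)
      = (α ^ 2 * (n : K) ^ 2) • q n - α • T := by
    rw [sum_sum_D_q hDq h]
    have : ∀ i ∈ Finset.range n, ∑ j ∈ Finset.range (n - 1 - i),
        p i * p j * q (n - 1 - i - 1 - j)
        = (α * n) • (p i * q (n - 1 - i))
          - α • ((i + 1 : ℕ) : K) • (p i * q (n - 1 - i)) := by
      intro i hi
      simp only [mul_assoc]
      rw [← Finset.mul_sum, hpq, mul_smul_comm, smul_smul, ← sub_smul]
      congr 1
      rw [Finset.mem_range] at hi
      rw [Nat.sub_sub, Nat.cast_sub (by omega)]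
      push_cast
      ring
    rw [Finset.sum_congr rfl this, Finset.sum_sub_distrib, ← Finset.smul_sum, ← Finset.smul_sum,
      hpq, smul_smul]
    congr 2
    ring
  rw [lap_apply]
  simp only [D_D_q hDq, Finset.sum_add_distrib, h1, h2, h3]
  match_scalars <;> field_simp <;> ring

theorem sum_p_succ_mul_q (hpq : ∀ n : ℕ, ∑ i ∈ Finset.range n, p i * q (n - 1 - i) = (α * n) • q n)
    (a : ℕ) :
    ∑ i ∈ Finset.range a, p (i + 1) * q (a - 1 - i)
      = (α * (a + 1 : ℕ)) • q (a + 1) - p 0 * q a := by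
  rw [← hpq, Finset.sum_range_succ', eq_sub_iff_add_eq]
  congr 1
  refine Finset.sum_congr rfl fun i _ => ?_
  congr 2
  omega

variable (p q) in
/-- The double sum that computes `gam` on two one-row functions. -/
def rowPair (a b : ℕ) : A :=
  ∑ i ∈ Finset.range a, ∑ j ∈ Finset.range b,
    p (i + j + 1) * (q (a - 1 - i) * q (b - 1 - j))

/-- Splitting off `j = 0` on the left and `i = 0` on the right leaves the same double sum. The
boundary terms are given by Euler's identity, and their `p_1 q_a q_b` parts cancel. -/
theorem rowPair_succ (hpq : ∀ n : ℕ, ∑ i ∈ Finset.range n, p i * q (n - 1 - i) = (α * n) • q n)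
    (a b : ℕ) : rowPair p q a (b + 1) = rowPair p q (a + 1) b
    + α • (((a + 1 : ℕ) : K) • (q (a + 1) * q b) - ((b + 1 : ℕ) : K) • (q a * q (b + 1))) := by
  have h1 : rowPair p q a (b + 1) =
      ∑ i ∈ Finset.range a, ∑ j ∈ Finset.range b,
        p (i + j + 2) * (q (a - 1 - i) * q (b - 1 - j))
      + (∑ i ∈ Finset.range a, p (i + 1) * q (a - 1 - i)) * q b := by
    rw [rowPair, Finset.sum_mul, ← Finset.sum_add_distrib]
    refine Finset.sum_congr rfl fun i _ => ?_
    rw [Finset.sum_range_succ']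
    congr 1
    · refine Finset.sum_congr rfl fun j _ => ?_
      rw [show b + 1 - 1 - (j + 1) = b - 1 - j by omega, ← add_assoc i j 1]
    · simp only [add_zero, Nat.add_sub_cancel, Nat.sub_zero]; ring
  have h2 : rowPair p q (a + 1) b =
      ∑ i ∈ Finset.range a, ∑ j ∈ Finset.range b,
        p (i + j + 2) * (q (a - 1 - i) * q (b - 1 - j))
      + q a * (∑ j ∈ Finset.range b, p (j + 1) * q (b - 1 - j)) := by
    rw [rowPair, Finset.sum_range_succ', Finset.mul_sum]
    congr 1
    · refine Finset.sum_congr rfl fun i _ => Finset.sum_congr rfl fun j _ => ?_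
      rw [show a + 1 - 1 - (i + 1) = a - 1 - i by omega, show i + 1 + j + 1 = i + j + 2 by ring]
    · refine Finset.sum_congr rfl fun j _ => ?_
      simp only [zero_add, Nat.add_sub_cancel, Nat.sub_zero]; ring
  rw [h1, h2, sum_p_succ_mul_q hpq, sum_p_succ_mul_q hpq]
  simp only [sub_mul, mul_sub, smul_mul_assoc, mul_smul_comm, smul_sub, smul_smul]
  ring

/-- Squares pass one at a time from `b` to `a`. The coefficients agree because `a - (b + 1) + 2 (k +
2) = (a + 1) - b + 2 (k + 1)`. -/
theorem rowPair_eq (hpq : ∀ n : ℕ, ∑ i ∈ Finset.range n, p i * q (n - 1 - i) = (α * n) • q n)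
    (hα : α ≠ 0) (a b : ℕ) : α⁻¹ • rowPair p q a b
    = ∑ k ∈ Finset.range b, ((a : K) - b + 2 * (k + 1 : ℕ)) •
        (q (a + (k + 1)) * q (b - (k + 1)))
      - (b : K) • (q a * q b) := by
  induction b generalizing a with
  | zero => simp [rowPair]
  | succ b ih =>
    rw [rowPair_succ hpq, smul_add, ih, smul_smul, inv_mul_cancel₀ hα, one_smul,
      Finset.sum_range_succ']
    have : ∑ k ∈ Finset.range b, ((a : K) - (b + 1 : ℕ) + 2 * (k + 1 + 1 : ℕ)) •
        (q (a + (k + 1 + 1)) * q (b + 1 - (k + 1 + 1)))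
        = ∑ k ∈ Finset.range b, (((a + 1 : ℕ) : K) - b + 2 * (k + 1 : ℕ)) •
        (q (a + 1 + (k + 1)) * q (b - (k + 1))) := by
      refine Finset.sum_congr rfl fun k _ => ?_
      congr 1
      · push_cast; ring
      · congr 2
        · ring
        · omega
    rw [this]
    simp only [zero_add, Nat.add_sub_cancel]
    push_cast
    match_scalars <;> ring

theorem gam_q (hDq : ∀ i n, D i (q n) = if i < n then q (n - 1 - i) else 0)
    (hpq : ∀ n : ℕ, ∑ i ∈ Finset.range n, p i * q (n - 1 - i) = (α * n) • q n)
    (hα : α ≠ 0) {a b N : ℕ} (ha : a ≤ N) (hb : b ≤ N) : gam α p D N (q a) (q b)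
    = ∑ k ∈ Finset.range b, ((a : K) - b + 2 * (k + 1 : ℕ)) •
        (q (a + (k + 1)) * q (b - (k + 1)))
      - (b : K) • (q a * q b) := by
  rw [← rowPair_eq hpq hα, gam, rowPair]
  congr 1
  rw [sum_range_of_zero ha]
  · refine Finset.sum_congr rfl fun i hi => ?_
    rw [sum_range_of_zero hb]
    · refine Finset.sum_congr rfl fun j hj => ?_
      rw [hDq, hDq, if_pos (Finset.mem_range.1 hi), if_pos (Finset.mem_range.1 hj)]
    · intro j hj
      rw [hDq j, if_neg (by omega), mul_zero, mul_zero]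
  · intro i hi
    refine Finset.sum_eq_zero fun j _ => ?_
    rw [hDq i, if_neg (by omega), zero_mul, mul_zero]

/-- Each pair of rows `x < y` contributes `-a y` to the diagonal through `gam_q`. Row `y` has `y`
rows before it, whence the term `-y * a y`. -/
theorem lap_prod_q [CharZero K] (hDq : ∀ i n, D i (q n) = if i < n then q (n - 1 - i) else 0)
    (hpq : ∀ n : ℕ, ∑ i ∈ Finset.range n, p i * q (n - 1 - i) = (α * n) • q n)
    (hα : α ≠ 0) (N : ℕ) (a : ℕ → ℕ) (s : ℕ) (ha : ∀ x < s, a x ≤ N) :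
    lap α p D N (∏ z ∈ Finset.range s, q (a z))
    = (∑ x ∈ Finset.range s, ((α * (a x : K) ^ 2 - a x) / 2 - x * a x)) •
        ∏ z ∈ Finset.range s, q (a z)
      + ∑ y ∈ Finset.range s, ∑ x ∈ Finset.range y, ∑ k ∈ Finset.range (a y),
        ((a x : K) - a y + 2 * (k + 1 : ℕ)) •
          ∏ z ∈ Finset.range s, q (moveRow a x y (k + 1) z) := by
  induction s with
  | zero =>
    have : lap α p D N 1 = 0 := by simp [lap_apply]
    simp [this]
  | succ s ih =>
    rw [Finset.prod_range_succ, lap_mul, ih fun x hx => ha x (by omega),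
      lap_q hDq hpq hα (ha s (by omega)), gam_prod_left]
    have h1 : ∀ x ∈ Finset.range s, gam α p D N (q (a x)) (q (a s)) *
          ∏ j ∈ (Finset.range s).erase x, q (a j)
        = ∑ k ∈ Finset.range (a s), ((a x : K) - a s + 2 * (k + 1 : ℕ)) •
          ∏ z ∈ Finset.range (s + 1), q (moveRow a x s (k + 1) z)
          - (a s : K) • ((∏ z ∈ Finset.range s, q (a z)) * q (a s)) := by
      intro x hx
      have hxs := Finset.mem_range.1 hx
      rw [gam_q hDq hpq hα (ha x (by omega)) (ha s (by omega)), sub_mul, Finset.sum_mul]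
      congr 1
      · refine Finset.sum_congr rfl fun k _ => ?_
        rw [smul_mul_assoc, Finset.prod_range_succ, ← Finset.mul_prod_erase _ _ hx]
        have e1 : moveRow a x s (k + 1) x = a x + (k + 1) := by simp [moveRow]
        have e2 : moveRow a x s (k + 1) s = a s - (k + 1) := by
          simp [moveRow, show s ≠ x by omega]
        have e3 : ∏ z ∈ (Finset.range s).erase x, q (moveRow a x s (k + 1) z)
            = ∏ z ∈ (Finset.range s).erase x, q (a z) := by
          refine Finset.prod_congr rfl fun z hz => ?_
          obtain ⟨hz1, hz2⟩ := Finset.mem_erase.1 hz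
          rw [Finset.mem_range] at hz2
          rw [moveRow, if_neg hz1, if_neg (by omega)]
        rw [e1, e2, e3]
        congr 1
        ring
      · rw [smul_mul_assoc, ← Finset.mul_prod_erase _ _ hx]
        congr 1
        ring
    have h2 : ∑ y ∈ Finset.range s, ∑ x ∈ Finset.range y, ∑ k ∈ Finset.range (a y),
        ((a x : K) - a y + 2 * (k + 1 : ℕ)) •
          ∏ z ∈ Finset.range (s + 1), q (moveRow a x y (k + 1) z)
        = (∑ y ∈ Finset.range s, ∑ x ∈ Finset.range y, ∑ k ∈ Finset.range (a y),
        ((a x : K) - a y + 2 * (k + 1 : ℕ)) •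
          ∏ z ∈ Finset.range s, q (moveRow a x y (k + 1) z)) * q (a s) := by
      simp only [Finset.sum_mul]
      refine Finset.sum_congr rfl fun y hy => Finset.sum_congr rfl fun x hx =>
        Finset.sum_congr rfl fun k _ => ?_
      rw [Finset.mem_range] at hx hy
      rw [Finset.prod_range_succ, smul_mul_assoc]
      congr 3
      rw [moveRow, if_neg (by omega), if_neg (by omega)]
    have h3 := Finset.sum_congr (s₁ := Finset.range s) rfl h1
    rw [Finset.sum_sub_distrib, Finset.sum_const, Finset.card_range,
      ← Nat.cast_smul_eq_nsmul K] at h3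
    rw [h3, Finset.sum_range_succ, Finset.sum_range_succ (n := s), h2]
    simp only [add_mul, smul_mul_assoc, mul_smul_comm]
    match_scalars <;> ring

end LaplaceBeltrami

end Jack
end

noncomputable section

namespace Jack

/-! ### Rows of partitions and the dominance order -/

variable {n : ℕ}

theorem row_antitone (lam : n.Partition) : Antitone (row lam) := by
  intro i j hij
  unfold row
  set l := lam.parts.sort (· ≥ ·) with hl
  have hs : l.Pairwise (· ≥ ·) := Multiset.pairwise_sort _ _
  by_cases hj : j < l.length
  · rw [List.getD_eq_getElem _ _ hj, List.getD_eq_getElem _ _ (hij.trans_lt hj)]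
    rcases hij.eq_or_lt with rfl | h
    · exact le_rfl
    · exact List.pairwise_iff_getElem.1 hs i j _ _ h
  · rw [List.getD_eq_default _ _ (not_lt.1 hj)]
    exact Nat.zero_le _

theorem row_eq_zero (lam : n.Partition) {i : ℕ} (h : length lam ≤ i) : row lam i = 0 := by
  unfold row
  rw [List.getD_eq_default]
  simpa [length] using h

theorem map_row_range (lam : n.Partition) :
    (Multiset.range (length lam)).map (row lam) = lam.parts := by
  conv_rhs => rw [← Multiset.sort_eq lam.parts (· ≥ ·)]
  rw [← Multiset.coe_range, Multiset.map_coe]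
  congr 1
  refine List.ext_getElem (by simp [length]) fun i h1 h2 => ?_
  simp only [List.getElem_map, List.getElem_range, row]
  exact List.getD_eq_getElem _ _ h2

theorem prod_map_parts {M : Type*} [CommMonoid M] (lam : n.Partition) (g : ℕ → M) :
    (lam.parts.map g).prod = ∏ x ∈ Finset.range (length lam), g (row lam x) := by
  conv_lhs => rw [← map_row_range lam, Multiset.map_map]
  rfl

theorem sum_map_parts {M : Type*} [AddCommMonoid M] (lam : n.Partition) (g : ℕ → M) :
    (lam.parts.map g).sum = ∑ x ∈ Finset.range (length lam), g (row lam x) := by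
  conv_lhs => rw [← map_row_range lam, Multiset.map_map]
  rfl

theorem length_le (lam : n.Partition) : length lam ≤ n := by
  conv_rhs => rw [← lam.parts_sum]
  simpa [length] using Multiset.card_nsmul_le_sum (s := lam.parts) (a := 1)
    fun x hx => lam.parts_pos hx

theorem row_pos (lam : n.Partition) {i : ℕ} (h : i < length lam) : 0 < row lam i := by
  apply lam.parts_pos
  rw [← map_row_range lam]
  exact Multiset.mem_map_of_mem _ (Multiset.mem_range.2 h)

theorem row_le (lam : n.Partition) (i : ℕ) : row lam i ≤ n := by
  by_cases h : i < length lam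
  · conv_rhs => rw [← sum_row lam]
    exact Finset.single_le_sum (f := row lam) (fun _ _ => Nat.zero_le _) (Finset.mem_range.2 h)
  · rw [row_eq_zero lam (not_lt.1 h)]
    exact Nat.zero_le _

theorem eq_of_row_eq {lam mu : n.Partition} (h : ∀ i, row lam i = row mu i) : lam = mu := by
  have hlen : length lam = length mu := by
    rcases lt_trichotomy (length lam) (length mu) with h1 | h1 | h1
    · have := row_pos mu h1
      rw [← h, row_eq_zero lam le_rfl] at this
      omega
    · exact h1
    · have := row_pos lam h1
      rw [h, row_eq_zero mu le_rfl] at this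
      omega
  ext1
  rw [← map_row_range lam, ← map_row_range mu, hlen]
  exact Multiset.map_congr rfl fun i _ => h i

theorem DomLE.refl (lam : n.Partition) : DomLE lam lam := fun _ => le_rfl

theorem DomLE.trans {lam mu nu : n.Partition} (h1 : DomLE lam mu) (h2 : DomLE mu nu) :
    DomLE lam nu := fun i => (h1 i).trans (h2 i)

theorem DomLE.antisymm {lam mu : n.Partition} (h1 : DomLE lam mu) (h2 : DomLE mu lam) :
    lam = mu := by
  refine eq_of_row_eq fun i => ?_
  have e1 := le_antisymm (h1 i) (h2 i)
  have e2 := le_antisymm (h1 (i + 1)) (h2 (i + 1))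
  rw [Finset.sum_range_succ, Finset.sum_range_succ, e1] at e2
  omega

/-- The sum of the squares of the parts. -/
def sumSq (lam : n.Partition) : ℕ := (lam.parts.map (· ^ 2)).sum

theorem sumSq_eq_of_length_le (lam : n.Partition) {N : ℕ} (h : length lam ≤ N) :
    sumSq lam = ∑ x ∈ Finset.range N, row lam x ^ 2 := by
  rw [sumSq, sum_map_parts, sum_range_of_zero h]
  intro i hi
  rw [row_eq_zero lam hi]
  rfl

theorem sumSq_le (lam : n.Partition) : sumSq lam ≤ n ^ 2 := by
  rw [sumSq_eq_of_length_le lam le_rfl]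
  calc ∑ x ∈ Finset.range (length lam), row lam x ^ 2
      ≤ ∑ x ∈ Finset.range (length lam), row lam x * n :=
        Finset.sum_le_sum fun x _ => by rw [sq]; exact Nat.mul_le_mul_left _ (row_le lam x)
    _ = n ^ 2 := by rw [← Finset.sum_mul, sum_row, sq]

/-- Abel summation, in a form suited to induction. -/
theorem mul_sum_range_le_sum_mul {b : ℕ → ℤ} (hb : Antitone b) {d : ℕ → ℤ}
    (hd : ∀ m, 0 ≤ ∑ x ∈ Finset.range m, d x) (m : ℕ) :
    b m * ∑ x ∈ Finset.range m, d x ≤ ∑ x ∈ Finset.range m, b x * d x := by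
  induction m with
  | zero => simp
  | succ m ih =>
    have h1 := mul_le_mul_of_nonneg_right (hb (Nat.le_succ m)) (hd (m + 1))
    rw [Finset.sum_range_succ, Finset.sum_range_succ] at *
    simp only [Nat.succ_eq_add_one] at h1
    linarith [mul_add (b m) (∑ x ∈ Finset.range m, d x) (d m)]

/-- `∑ λ² - ∑ μ² = ∑ (λ - μ)² + 2 ∑ μ (λ - μ)`, and the last sum is nonnegative by Abel summation.
This separates the eigenvalues of comparable partitions. -/
theorem DomLT.sumSq_lt {mu lam : n.Partition} (h : DomLT mu lam) : sumSq mu < sumSq lam := by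
  obtain ⟨hle, hne⟩ := h
  have hrow : ∃ i, row mu i ≠ row lam i := by
    by_contra hc
    exact hne (eq_of_row_eq fun i => by_contra fun h => hc ⟨i, h⟩)
  obtain ⟨i, hi⟩ := hrow
  -- Large enough to cover both lengths and the row `i` where the partitions differ.
  set N := n + i + 1
  rw [sumSq_eq_of_length_le mu (N := N) ((length_le mu).trans (by omega)),
    sumSq_eq_of_length_le lam (N := N) ((length_le lam).trans (by omega))]
  zify
  have hd : ∀ m, 0 ≤ ∑ x ∈ Finset.range m, ((row lam x : ℤ) - row mu x) := by
    intro m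
    rw [Finset.sum_sub_distrib, sub_nonneg]
    exact_mod_cast hle m
  have habel := mul_sum_range_le_sum_mul (b := fun x => (row mu x : ℤ))
    (fun x y hxy => Int.ofNat_le.2 (row_antitone mu hxy)) hd N
  have h0 := mul_nonneg (Int.natCast_nonneg (row mu N)) (hd N)
  have hpos : 0 < ∑ x ∈ Finset.range N, ((row lam x : ℤ) - row mu x) ^ 2 := by
    refine Finset.sum_pos' (fun _ _ => sq_nonneg _) ⟨i, Finset.mem_range.2 (by omega), ?_⟩
    have : (row lam i : ℤ) - row mu i ≠ 0 := by
      intro h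
      apply hi
      omega
    positivity
  have key : ∑ x ∈ Finset.range N, (row lam x : ℤ) ^ 2 = ∑ x ∈ Finset.range N, (row mu x : ℤ) ^ 2
      + ∑ x ∈ Finset.range N, ((row lam x : ℤ) - row mu x) ^ 2
      + 2 * ∑ x ∈ Finset.range N, (row mu x : ℤ) * ((row lam x : ℤ) - row mu x) := by
    rw [Finset.mul_sum, ← Finset.sum_add_distrib, ← Finset.sum_add_distrib]
    exact Finset.sum_congr rfl fun x _ => by ring
  linarith

/-- Exchange argument: if the head of the decreasing list is missing from `t`, it is at least as
large as any element of `t` and can replace one. Hence sorting can only raise partial sums. -/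
theorem sum_le_sum_take {l : List ℕ} (hl : l.Pairwise (· ≥ ·)) {t : Multiset ℕ}
    (ht : t ≤ (l : Multiset ℕ)) {m : ℕ} (hm : Multiset.card t ≤ m) : t.sum ≤ (l.take m).sum := by
  induction l generalizing t m with
  | nil => simp_all
  | cons a l ih =>
    rw [List.pairwise_cons] at hl
    rcases m with _ | m
    · simp_all
    rw [List.take_succ_cons, List.sum_cons]
    by_cases ha : a ∈ t
    · obtain ⟨t, rfl⟩ := Multiset.exists_cons_of_mem ha
      rw [← Multiset.cons_coe, Multiset.cons_le_cons_iff] at ht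
      rw [Multiset.sum_cons]
      exact Nat.add_le_add_left (ih hl.2 ht (by simpa using hm)) _
    · rw [← Multiset.cons_coe, Multiset.le_cons_of_notMem ha] at ht
      rcases t.empty_or_exists_mem with rfl | ⟨b, hb⟩
      · simp
      · have hba : b ≤ a := hl.1 b (by simpa using Multiset.mem_of_le ht hb)
        obtain ⟨t, rfl⟩ := Multiset.exists_cons_of_mem hb
        rw [Multiset.sum_cons]
        exact Nat.add_le_add hba
          (ih hl.2 ((Multiset.le_cons_self _ _).trans ht) (by simpa using hm))

theorem sum_le_sum_row (lam : n.Partition) {t : Multiset ℕ} (ht : t ≤ lam.parts) {m : ℕ}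
    (hm : Multiset.card t ≤ m) : t.sum ≤ ∑ x ∈ Finset.range m, row lam x := by
  have hs := sum_le_sum_take (l := lam.parts.sort (· ≥ ·)) (Multiset.pairwise_sort _ _)
    (t := t) (by rwa [Multiset.sort_eq]) hm
  refine hs.trans_eq ?_
  unfold row
  generalize lam.parts.sort (· ≥ ·) = l
  clear hs hm
  induction l generalizing m with
  | nil => simp
  | cons a l ih =>
    rcases m with _ | m
    · simp
    · rw [List.take_succ_cons, List.sum_cons, Finset.sum_range_succ', ih]
      simp [add_comm]

/-! ### Moving up operators -/

theorem IsMove.lt_length {lam : n.Partition} {r : Move} (h : IsMove lam r) : r.j < length lam := by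
  by_contra hc
  have := row_eq_zero lam (not_lt.1 hc)
  have h1 := h.2.1
  have h2 := h.2.2
  omega

theorem parts_moveUp {lam : n.Partition} {r : Move} (h : IsMove lam r) : (moveUp lam r).parts
    = ((Multiset.range (length lam)).map (movedRow lam r)).filter (· ≠ 0) := by
  rw [moveUp, dif_pos h]
  rfl

theorem prod_map_filter_ne_zero {M : Type*} [CommMonoid M] (s : Multiset ℕ) {g : ℕ → M}
    (hg : g 0 = 1) : ((s.filter (· ≠ 0)).map g).prod = (s.map g).prod := by
  induction s using Multiset.induction_on with
  | empty => simp
  | cons a s ih =>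
    by_cases ha : a = 0
    · subst ha
      rw [Multiset.filter_cons_of_neg (p := fun a : ℕ => a ≠ 0) s (not_not.2 rfl), ih,
        Multiset.map_cons, Multiset.prod_cons, hg, one_mul]
    · rw [Multiset.filter_cons_of_pos (p := fun a : ℕ => a ≠ 0) s ha, Multiset.map_cons,
        Multiset.prod_cons, ih,
        Multiset.map_cons, Multiset.prod_cons]

theorem sum_filter_ne_zero (s : Multiset ℕ) : (s.filter (· ≠ 0)).sum = s.sum := by
  conv_rhs => rw [← Multiset.filter_add_not (· ≠ 0) s, Multiset.sum_add]
  rw [Multiset.sum_eq_zero (s := s.filter fun a => ¬a ≠ 0), add_zero]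
  intro x hx
  simpa using Multiset.of_mem_filter hx

theorem prod_parts_moveUp {M : Type*} [CommMonoid M] {lam : n.Partition} {r : Move}
    (h : IsMove lam r) {g : ℕ → M} (hg : g 0 = 1) :
    ((moveUp lam r).parts.map g).prod
      = ∏ x ∈ Finset.range (length lam), g (movedRow lam r x) := by
  rw [parts_moveUp h, prod_map_filter_ne_zero _ hg, Multiset.map_map]
  rfl

theorem sum_movedRow_add {lam : n.Partition} {r : Move} (h : IsMove lam r) (m : ℕ) :
    ∑ x ∈ Finset.range m, movedRow lam r x + (if r.j < m then r.k else 0)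
      = ∑ x ∈ Finset.range m, row lam x + (if r.i < m then r.k else 0) := by
  obtain ⟨hij, hk, hkj⟩ := h
  induction m with
  | zero => simp
  | succ m ih =>
    rw [Finset.sum_range_succ, Finset.sum_range_succ]
    have : movedRow lam r m + (if m = r.j then r.k else 0)
        = row lam m + (if m = r.i then r.k else 0) := by
      unfold movedRow
      split_ifs with h1 h2 h2
      · omega
      · rfl
      · subst h2; omega
      · rfl
    split_ifs at * <;> omega

/-- The increase is `2k (λ_i - λ_j + k)`, positive since `λ_i ≥ λ_j`. -/
theorem sumSq_lt_moveUp {lam : n.Partition} {r : Move} (h : IsMove lam r) :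
    sumSq lam < sumSq (moveUp lam r) := by
  have h1 : sumSq (moveUp lam r)
      = ∑ x ∈ Finset.range (length lam), movedRow lam r x ^ 2 := by
    have := prod_parts_moveUp (M := Multiplicative ℕ) h
      (g := fun m => Multiplicative.ofAdd (m ^ 2)) rfl
    exact this
  have hj := h.lt_length
  obtain ⟨hij, hk, hkj⟩ := h
  rw [h1, sumSq_eq_of_length_le lam le_rfl]
  have hi : r.i ∈ (Finset.range (length lam)).erase r.j :=
    Finset.mem_erase.2 ⟨hij.ne, Finset.mem_range.2 (by omega)⟩
  rw [← Finset.add_sum_erase _ _ (Finset.mem_range.2 hj), ← Finset.add_sum_erase _ _ hi,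
    ← Finset.add_sum_erase (a := r.j) _ _ (Finset.mem_range.2 hj), ← Finset.add_sum_erase _ _ hi]
  have h3 : ∑ x ∈ ((Finset.range (length lam)).erase r.j).erase r.i, movedRow lam r x ^ 2
      = ∑ x ∈ ((Finset.range (length lam)).erase r.j).erase r.i, row lam x ^ 2 := by
    refine Finset.sum_congr rfl fun x hx => ?_
    obtain ⟨hx1, hx2⟩ := Finset.mem_erase.1 hx
    rw [movedRow, if_neg hx1, if_neg (Finset.ne_of_mem_erase hx2)]
  have e1 : movedRow lam r r.i = row lam r.i + r.k := by simp [movedRow]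
  have e2 : movedRow lam r r.j = row lam r.j - r.k := by simp [movedRow, hij.ne']
  rw [h3, e1, e2, ← add_assoc, ← add_assoc]
  refine Nat.add_lt_add_right ?_ _
  have := row_antitone lam hij.le
  obtain ⟨u, hu⟩ := Nat.exists_eq_add_of_le hkj
  rw [hu] at this ⊢
  rw [Nat.add_sub_cancel_left]
  nlinarith

/-- Before sorting, the partial sums do not drop because `k` is added in an earlier row than it is
removed from; sorting only raises them further. -/
theorem domLE_moveUp {lam : n.Partition} {r : Move} (h : IsMove lam r) :
    DomLE lam (moveUp lam r) := by
  intro m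
  set m' := min m (length lam)
  have h1 : ∑ x ∈ Finset.range m, row lam x = ∑ x ∈ Finset.range m', row lam x := by
    rcases le_total m (length lam) with hm | hm
    · rw [show m' = m from min_eq_left hm]
    · rw [show m' = length lam from min_eq_right hm]
      exact sum_range_of_zero hm _ fun i hi => row_eq_zero lam hi
  have h2 : ∑ x ∈ Finset.range m', row lam x ≤ ∑ x ∈ Finset.range m', movedRow lam r x := by
    have := sum_movedRow_add h m'
    have hij := h.1
    split_ifs at this <;> omega
  have h3 : ((Multiset.range m').map (movedRow lam r)).filter (· ≠ 0) ≤ (moveUp lam r).parts := by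
    rw [parts_moveUp h]
    refine Multiset.filter_le_filter _ (Multiset.map_le_map ?_)
    exact Multiset.range_le.2 (min_le_right _ _)
  have h4 : Multiset.card (((Multiset.range m').map (movedRow lam r)).filter (· ≠ 0)) ≤ m := by
    refine (Multiset.card_le_card (Multiset.filter_le _ _)).trans ?_
    simp [m']
  refine (h1.trans_le h2).trans ((Eq.le ?_).trans (sum_le_sum_row _ h3 h4))
  rw [sum_filter_ne_zero]
  rfl

/-- The moving up operators for `lam`. -/
def moves (lam : n.Partition) : Finset Move :=
  ((Finset.range (length lam)).sigma fun y => (Finset.range y).sigma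
    fun _ => Finset.range (row lam y)).map
    ⟨fun t => ⟨t.2.1, t.1, t.2.2 + 1⟩, by
      rintro ⟨y, x, k⟩ ⟨y', x', k'⟩ h
      simp only [Move.mk.injEq, Nat.add_right_cancel_iff] at h
      obtain ⟨rfl, rfl, rfl⟩ := h
      rfl⟩

theorem mem_moves {lam : n.Partition} {r : Move} : r ∈ moves lam ↔ IsMove lam r := by
  simp only [moves, Finset.mem_map, Finset.mem_sigma, Finset.mem_range]
  constructor
  · rintro ⟨⟨y, x, k⟩, ⟨_, h2, h3⟩, rfl⟩
    exact ⟨h2, Nat.succ_pos _, h3⟩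
  · intro h
    obtain ⟨i, j, k⟩ := r
    obtain ⟨k, rfl⟩ := Nat.exists_eq_add_of_lt h.2.1
    exact ⟨⟨j, i, k⟩, ⟨h.lt_length, h.1, by simpa using h.2.2⟩, by rw [Nat.zero_add]; rfl⟩

theorem sum_moves {M : Type*} [AddCommMonoid M] (lam : n.Partition) (f : Move → M) :
    ∑ r ∈ moves lam, f r = ∑ y ∈ Finset.range (length lam), ∑ x ∈ Finset.range y,
      ∑ k ∈ Finset.range (row lam y), f ⟨x, y, k + 1⟩ := by
  rw [moves, Finset.sum_map, Finset.sum_sigma]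
  refine Finset.sum_congr rfl fun y _ => ?_
  rw [Finset.sum_sigma]
  rfl

/-! ### Sequences of moving up operators -/

/-- The tree of moves is finitely branching, and its depth is bounded because `sumSq` rises at each
move and stays at most `n ^ 2`. -/
theorem finite_isMoveSeq (lam : n.Partition) : {rs : List Move | IsMoveSeq lam rs}.Finite := by
  induction hk : n ^ 2 - sumSq lam using Nat.strong_induction_on generalizing lam with
  | _ k ih =>
    have hsub : {rs : List Move | IsMoveSeq lam rs} ⊆ {[]} ∪ ⋃ r ∈ (moves lam : Set Move),
        (fun rs => r :: rs) '' {rs : List Move | IsMoveSeq (moveUp lam r) rs} := by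
      rintro (_ | ⟨r, rs⟩) h
      · exact Or.inl rfl
      · refine Or.inr (Set.mem_biUnion (x := r) (mem_moves.2 h.1) ⟨rs, h.2, rfl⟩)
    refine Set.Finite.subset ((Set.finite_singleton _).union ?_) hsub
    refine (moves lam).finite_toSet.biUnion fun r hr => Set.Finite.image _ (ih _ ?_ _ rfl)
    have h1 := sumSq_lt_moveUp (mem_moves.1 hr)
    have h2 := sumSq_le (moveUp lam r)
    omega

theorem applySeq_append_singleton (lam : n.Partition) (rs : List Move) (r : Move) :
    applySeq lam (rs ++ [r]) = moveUp (applySeq lam rs) r := by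
  simp [applySeq]

theorem isMoveSeq_append_singleton {lam : n.Partition} {rs : List Move} {r : Move} :
    IsMoveSeq lam (rs ++ [r]) ↔ IsMoveSeq lam rs ∧ IsMove (applySeq lam rs) r := by
  induction rs generalizing lam with
  | nil => simp [IsMoveSeq, applySeq]
  | cons a rs ih =>
    rw [List.cons_append]
    simp only [IsMoveSeq]
    rw [ih, and_assoc]
    rfl

theorem IsMoveSeq.domLE {lam : n.Partition} {rs : List Move} (h : IsMoveSeq lam rs) :
    DomLE lam (applySeq lam rs) := by
  induction rs generalizing lam with
  | nil => exact DomLE.refl _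
  | cons r rs ih => exact (domLE_moveUp h.1).trans (ih h.2)

theorem IsMoveSeq.sumSq_add_length_le {lam : n.Partition} {rs : List Move}
    (h : IsMoveSeq lam rs) : sumSq lam + rs.length ≤ sumSq (applySeq lam rs) := by
  induction rs generalizing lam with
  | nil => exact le_rfl
  | cons r rs ih =>
    have h1 := sumSq_lt_moveUp h.1
    have h2 := ih h.2
    have h3 : applySeq lam (r :: rs) = applySeq (moveUp lam r) rs := rfl
    rw [h3, List.length_cons]
    omega

theorem IsMoveSeq.sumSq_lt {lam : n.Partition} {rs : List Move}
    (h : IsMoveSeq lam rs) (hrs : rs ≠ []) : sumSq lam < sumSq (applySeq lam rs) := by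
  have := h.sumSq_add_length_le
  have := List.length_pos_iff.2 hrs
  omega

/-! ### Separation of the eigenvalues -/

theorem ePrime_eq (lam : n.Partition) : ePrime lam = algebraMap (Polynomial ℚ) F
    (Polynomial.C (1 / 2 * (sumSq lam : ℚ)) * Polynomial.X
      - Polynomial.C ((∑ x ∈ Finset.range (length lam), (x + 1) * row lam x : ℕ) : ℚ)) := by
  rw [ePrime, sumSq_eq_of_length_le lam le_rfl, map_sub, map_mul, RatFunc.algebraMap_X,
    RatFunc.algebraMap_C, RatFunc.algebraMap_C, alpha]
  push_cast [map_mul, map_sum]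
  simp
  ring

theorem sumSq_eq_of_ePrime_eq {lam mu : n.Partition} (h : ePrime lam = ePrime mu) :
    sumSq lam = sumSq mu := by
  rw [ePrime_eq, ePrime_eq] at h
  have := congrArg (Polynomial.coeff · 1) (IsFractionRing.injective (Polynomial ℚ) F h)
  simp only [Polynomial.coeff_sub, Polynomial.coeff_C_mul_X, Polynomial.coeff_C, if_true,
    one_ne_zero, if_false, sub_zero] at this
  exact_mod_cast mul_left_cancel₀ (by norm_num) this

end Jack
end

noncomputable section

namespace Jack

open MvPolynomial

/-! ### The eigenvectors of the Laplace–Beltrami operator -/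

variable {n : ℕ}

theorem q_eq_prod (lam : n.Partition) :
    q lam = ∏ x ∈ Finset.range (length lam), oneRow (row lam x) := prod_map_parts lam oneRow

theorem q_moveUp {lam : n.Partition} {r : Move} (h : IsMove lam r) :
    q (moveUp lam r) = ∏ x ∈ Finset.range (length lam), oneRow (movedRow lam r x) :=
  prod_parts_moveUp h oneRow_zero

/-- The numerator attached to a moving up operator. -/
def moveCoeff (lam : n.Partition) (r : Move) : F :=
  (row lam r.i : F) - (row lam r.j : F) + 2 * (r.k : F)

/-- The adjoint of multiplication by `p_{i+1}`. -/
abbrev perpS (i : ℕ) : Derivation F SymF SymF := perp i.succPNat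

/-- The Laplace–Beltrami operator on symmetric functions, right in degrees at most `N`. -/
def lapF (N : ℕ) : SymF →ₗ[F] SymF := lap alpha psum perpS N

theorem formL_lapF (N : ℕ) (f g : SymF) : formL (lapF N f) g = formL f (lapF N g) :=
  lap_selfAdjoint alpha psum perpS formL (fun _ => formL_X_mul _) (fun _ => formL_perp _) N f g

theorem lapF_q (lam : n.Partition) : lapF n (q lam) = (ePrime lam + n / 2) • q lam
    + ∑ r ∈ moves lam, moveCoeff lam r • q (moveUp lam r) := by
  have hD : ∀ i n, perpS i (oneRow n) = if i < n then oneRow (n - 1 - i) else 0 := by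
    intro i n
    split_ifs with h
    · exact perp_succ_oneRow h
    · exact perp_succ_oneRow_of_le (not_lt.1 h)
  have key := lap_prod_q (α := alpha) (p := psum) hD sum_psum_mul_oneRow alpha_ne_zero n (row lam)
    (length lam) fun x _ => row_le lam x
  rw [q_eq_prod, lapF, key]
  congr 1
  · congr 1
    -- The shift `n / 2` is `∑ λ_x / 2`: with rows counted from `0`, `-λ_x / 2 - x λ_x = -(x + 1)
    -- λ_x + λ_x / 2`.
    have h1 : (n : F) = ∑ x ∈ Finset.range (length lam), (row lam x : F) := by
      rw [← Nat.cast_sum, sum_row]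
    rw [ePrime, h1, Finset.mul_sum, Finset.sum_div, ← Finset.sum_sub_distrib,
      ← Finset.sum_add_distrib]
    refine Finset.sum_congr rfl fun x _ => ?_
    push_cast
    ring
  · rw [← sum_moves lam fun r => ((row lam r.i : F) - row lam r.j + 2 * (r.k : ℕ)) •
      ∏ z ∈ Finset.range (length lam), oneRow (moveRow (row lam) r.i r.j r.k z)]
    refine Finset.sum_congr rfl fun r hr => ?_
    rw [q_moveUp (mem_moves.1 hr)]
    rfl

theorem seqCoeff_nil (lam : n.Partition) : seqCoeff lam [] = 1 := by
  simp [seqCoeff]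

/-- All denominators refer to the starting partition, so the recursion has to split off the last
move, not the first. -/
theorem seqCoeff_append_singleton (lam : n.Partition) (rs : List Move) (r : Move) :
    seqCoeff lam (rs ++ [r]) = seqCoeff lam rs * (moveCoeff (applySeq lam rs) r
      / (ePrime lam - ePrime (applySeq lam (rs ++ [r])))) := by
  have hlen : (rs ++ [r]).length = rs.length + 1 := by simp
  unfold seqCoeff
  rw [← Fintype.prod_equiv (finCongr hlen.symm) _ _ fun _ => rfl, Fin.prod_univ_castSucc]
  congr 1
  · refine Finset.prod_congr rfl fun t _ => ?_
    have h1 : (rs ++ [r]).take t = rs.take t := List.take_append_of_le_length t.2.le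
    have h2 : (rs ++ [r]).take (t + 1) = rs.take (t + 1) := List.take_append_of_le_length t.2
    have h3 : (rs ++ [r])[(t : ℕ)]'(by have := t.2; omega) = rs[(t : ℕ)] :=
      List.getElem_append_left _
    simp only [finCongr_apply, Fin.val_cast, Fin.val_castSucc, Fin.getElem_fin, h1, h2, h3]
  · simp [moveCoeff, List.take_of_length_le]

/-- The sequences of moving up operators starting from `lam`. -/
def moveSeqs (lam : n.Partition) : Finset (List Move) := (finite_isMoveSeq lam).toFinset

theorem mem_moveSeqs {lam : n.Partition} {rs : List Move} :
    rs ∈ moveSeqs lam ↔ IsMoveSeq lam rs := by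
  simp [moveSeqs]

theorem ePrime_ne {lam : n.Partition} {rs : List Move} (h : IsMoveSeq lam rs) (hrs : rs ≠ []) :
    ePrime lam ≠ ePrime (applySeq lam rs) := fun he =>
  (h.sumSq_lt hrs).ne (sumSq_eq_of_ePrime_eq he)

/-- The explicit expansion of the dual Jack function `Q_lam`. -/
def jackQ (lam : n.Partition) : SymF :=
  ∑ rs ∈ moveSeqs lam, seqCoeff lam rs • q (applySeq lam rs)

theorem sum_moveSeqs_append_singleton {M : Type*} [AddCommGroup M] (lam : n.Partition)
    (g : List Move → M) (hg : g [] = 0) :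
    ∑ rs ∈ moveSeqs lam, ∑ r ∈ moves (applySeq lam rs), g (rs ++ [r])
      = ∑ rs ∈ moveSeqs lam, g rs := by
  classical
  have hnil : [] ∈ moveSeqs lam := mem_moveSeqs.2 trivial
  rw [← Finset.add_sum_erase _ g hnil, hg, zero_add, Finset.sum_sigma']
  refine Finset.sum_nbij (fun x => x.1 ++ [x.2]) ?_ ?_ ?_ fun _ _ => rfl
  · rintro ⟨rs, r⟩ h
    rw [Finset.mem_sigma, mem_moveSeqs, mem_moves] at h
    exact Finset.mem_erase.2 ⟨by simp, mem_moveSeqs.2 (isMoveSeq_append_singleton.2 h)⟩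
  · rintro ⟨rs, r⟩ _ ⟨rs', r'⟩ _ h
    obtain ⟨h1, h2⟩ := List.append_inj' h rfl
    simp only at h1 h2
    subst h1
    rw [List.singleton_inj.1 h2]
  · intro rs h
    rw [Finset.mem_coe, Finset.mem_erase, mem_moveSeqs] at h
    rcases List.eq_nil_or_concat rs with h0 | ⟨L, b, hL⟩
    · exact absurd h0 h.1
    · rw [List.concat_eq_append] at hL
      subst hL
      obtain ⟨h1, h2⟩ := isMoveSeq_append_singleton.1 h.2
      exact ⟨⟨L, b⟩, Finset.mem_sigma.2 ⟨mem_moveSeqs.2 h1, mem_moves.2 h2⟩, rfl⟩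

/-- Let `w rs` be the term of `rs` multiplied by `e'_lam - e'_end`, where `end` is the final
partition of `rs`. The operator sends the term of `rs` to its eigenvalue multiple, minus `w rs`,
plus `w` of all one-move extensions. The extensions run once through the nonempty sequences and `w
[] = 0`, so the corrections cancel. -/
theorem lapF_jackQ (lam : n.Partition) :
    lapF n (jackQ lam) = (ePrime lam + n / 2) • jackQ lam := by
  have hsum := sum_moveSeqs_append_singleton lam (fun rs =>
    (seqCoeff lam rs * (ePrime lam - ePrime (applySeq lam rs))) • q (applySeq lam rs)) (by
      simp [applySeq])
  rw [jackQ, map_sum, Finset.smul_sum]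
  have h1 : ∀ rs ∈ moveSeqs lam, lapF n (seqCoeff lam rs • q (applySeq lam rs))
      = (ePrime lam + n / 2) • (seqCoeff lam rs • q (applySeq lam rs))
        - (seqCoeff lam rs * (ePrime lam - ePrime (applySeq lam rs))) • q (applySeq lam rs)
        + ∑ r ∈ moves (applySeq lam rs), (seqCoeff lam (rs ++ [r]) *
          (ePrime lam - ePrime (applySeq lam (rs ++ [r])))) • q (applySeq lam (rs ++ [r])) := by
    intro rs hrs
    rw [map_smul, lapF_q, smul_add, Finset.smul_sum]
    congr 1
    · rw [smul_smul, smul_smul, ← sub_smul]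
      congr 1
      ring
    · refine Finset.sum_congr rfl fun r hr => ?_
      have hne := ePrime_ne (isMoveSeq_append_singleton.2
        ⟨mem_moveSeqs.1 hrs, mem_moves.1 hr⟩) (by simp)
      rw [seqCoeff_append_singleton, smul_smul, mul_assoc,
        div_mul_cancel₀ _ (sub_ne_zero.2 hne), applySeq_append_singleton]
  rw [Finset.sum_congr rfl h1, Finset.sum_add_distrib, Finset.sum_sub_distrib, hsum,
    sub_add_cancel]

/-! ### The functions `q` form a basis in each degree -/

/-- `f` is a symmetric function homogeneous of degree `n`. -/
abbrev IsHom (f : SymF) (n : ℕ) : Prop := IsWeightedHomogeneous (fun k : ℕ+ => (k : ℕ)) f n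

theorem isHom_oneRow (m : ℕ) : IsHom (oneRow m) m := by
  intro d hd
  rw [coeff_oneRow] at hd
  by_contra hc
  exact hd (if_neg hc)

theorem isHom_prod (s : Multiset ℕ) : IsHom (s.map oneRow).prod s.sum := by
  induction s using Multiset.induction_on with
  | empty => simpa using isWeightedHomogeneous_one F _
  | cons a s ih =>
    rw [Multiset.map_cons, Multiset.prod_cons, Multiset.sum_cons]
    exact (isHom_oneRow a).mul ih

theorem isHom_q (lam : n.Partition) : IsHom (q lam) n := by
  have := isHom_prod lam.parts
  rwa [lam.parts_sum] at this

theorem IsHom.smul {f : SymF} (c : F) (h : IsHom f n) : IsHom (c • f) n :=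
  (weightedHomogeneousSubmodule F (fun k : ℕ+ => (k : ℕ)) n).smul_mem c h

theorem isHom_sum_smul {ι : Type*} (s : Finset ι) (c : ι → F) (f : ι → SymF)
    (h : ∀ i, IsHom (f i) n) : IsHom (∑ i ∈ s, c i • f i) n :=
  IsWeightedHomogeneous.sum _ _ _ fun i _ => (h i).smul (c i)

theorem formL_eq_zero_of_isHom {a b : ℕ} {f g : SymF} (hf : IsHom f a) (hg : IsHom g b)
    (hab : a ≠ b) : formL f g = 0 := by
  rw [← form_eq, form]
  refine Finset.sum_eq_zero fun d hd => ?_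
  have h1 := hf (mem_support_iff.1 hd)
  have h2 : coeff d g = 0 := by
    by_contra hc
    exact hab (h1.symm.trans (hg hc))
  rw [h2, mul_zero, zero_mul]

theorem q_ofSums (s : Multiset ℕ) (h : s.sum = n) :
    q (Nat.Partition.ofSums n s h) = (s.map oneRow).prod :=
  prod_map_filter_ne_zero s oneRow_zero

/-- The span of the functions `q_lam` of degree `n`. -/
def qSpan (n : ℕ) : Submodule F SymF := Submodule.span F (Set.range (q : n.Partition → SymF))

theorem prod_mem_qSpan (s : Multiset ℕ) : (s.map oneRow).prod ∈ qSpan s.sum :=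
  Submodule.subset_span ⟨Nat.Partition.ofSums _ s rfl, q_ofSums s rfl⟩

theorem mul_mem_qSpan {a b : ℕ} {f g : SymF} (hf : f ∈ qSpan a) (hg : g ∈ qSpan b) :
    f * g ∈ qSpan (a + b) := by
  have h : qSpan a * qSpan b ≤ qSpan (a + b) := by
    rw [qSpan, qSpan, Submodule.span_mul_span, Submodule.span_le]
    rintro _ ⟨_, ⟨lam, rfl⟩, _, ⟨mu, rfl⟩, rfl⟩
    have := prod_mem_qSpan (lam.parts + mu.parts)
    rwa [Multiset.map_add, Multiset.prod_add, Multiset.sum_add, lam.parts_sum,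
      mu.parts_sum] at this
  exact h (Submodule.mul_mem_mul hf hg)

theorem oneRow_mem_qSpan (m : ℕ) : oneRow m ∈ qSpan m := by
  simpa using prod_mem_qSpan {m}

/-- Euler's identity can be solved for its last term `p_{i+1} q_0`, as `q_0 = 1`. -/
theorem psum_mem_qSpan (i : ℕ) : psum i ∈ qSpan (i + 1) := by
  induction i using Nat.strong_induction_on with
  | _ i ih =>
    have h := sum_psum_mul_oneRow (i + 1)
    rw [Finset.sum_range_succ, ← eq_sub_iff_add_eq'] at h
    have h0 : i + 1 - 1 - i = 0 := by omega
    rw [h0, oneRow_zero, mul_one] at h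
    rw [h]
    refine Submodule.sub_mem _ (Submodule.smul_mem _ _ (oneRow_mem_qSpan _))
      (Submodule.sum_mem _ fun j hj => ?_)
    rw [Finset.mem_range] at hj
    have := mul_mem_qSpan (ih j hj) (oneRow_mem_qSpan (i + 1 - 1 - j))
    rwa [show j + 1 + (i + 1 - 1 - j) = i + 1 by omega] at this

theorem monomial_mem_qSpan (d : ℕ+ →₀ ℕ) : monomial d (1 : F) ∈ qSpan (deg d) := by
  have h1 : (1 : SymF) ∈ qSpan 0 := by simpa using prod_mem_qSpan 0
  induction d using Finsupp.induction_linear with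
  | zero => simpa using h1
  | add d e hd he =>
    have : monomial (d + e) (1 : F) = monomial d 1 * monomial e 1 := by
      rw [monomial_mul, mul_one]
    rw [this, map_add]
    exact mul_mem_qSpan hd he
  | single k m =>
    rw [← X_pow_eq_monomial, deg_single]
    induction m with
    | zero => simpa using h1
    | succ m ih =>
      rw [pow_succ, Nat.succ_mul]
      refine mul_mem_qSpan ih ?_
      have := psum_mem_qSpan k.natPred
      rwa [psum, PNat.succPNat_natPred, PNat.natPred_add_one] at this

theorem isHom_ext {f : SymF} (hf : IsHom f n) (h : ∀ lam : n.Partition, formL (q lam) f = 0) :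
    f = 0 := by
  refine eq_zero_of_formL_monomial f fun d => ?_
  by_cases hd : deg d = n
  · subst hd
    have hle : qSpan (deg d) ≤ LinearMap.ker (formL.flip f) := by
      rw [qSpan, Submodule.span_le]
      rintro _ ⟨lam, rfl⟩
      exact h lam
    exact hle (monomial_mem_qSpan d)
  · exact formL_eq_zero_of_isHom (isWeightedHomogeneous_monomial _ d 1 rfl) hf hd

/-- Since the `q` span, their matrix `A` in power sums has a left inverse `B`; being square, `B` is
a two-sided inverse. The dual basis is read off from `B` after dividing by the weights. -/
theorem exists_dual_basis (n : ℕ) : ∃ m : n.Partition → SymF, (∀ mu, IsHom (m mu) n) ∧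
    ∀ lam mu, formL (q lam) (m mu) = (1 : Matrix n.Partition n.Partition F) lam mu := by
  set p : n.Partition → SymF := fun mu => monomial (expo mu) (1 : F) with hp
  have hB : ∀ mu : n.Partition, ∃ c : n.Partition → F, ∑ lam, c lam • q lam = p mu := by
    intro mu
    have := monomial_mem_qSpan (expo mu)
    rw [deg_expo, qSpan, Submodule.mem_span_range_iff_exists_fun] at this
    exact this
  choose B hB using hB
  set A : Matrix n.Partition n.Partition F :=
    Matrix.of fun lam mu => coeff (expo mu) (q lam)
  have hcoeff : ∀ lam mu : n.Partition, coeff (expo lam) (p mu)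
      = (1 : Matrix n.Partition n.Partition F) mu lam := by
    classical
    intro lam mu
    simp only [hp, coeff_monomial, Matrix.one_apply, (expo_injective n).eq_iff]
  have hBA : Matrix.of B * A = 1 := by
    ext mu lam
    rw [Matrix.mul_apply, ← hcoeff, ← hB mu, coeff_sum]
    refine Finset.sum_congr rfl fun nu _ => ?_
    rw [coeff_smul]
    rfl
  have hAB : A * Matrix.of B = 1 := mul_eq_one_comm.1 hBA
  have hpairing : ∀ lam nu : n.Partition, formL (q lam) (p nu) = A lam nu * weight (expo nu) := by
    intro lam nu
    rw [formL_comm, formL_monomial_left, one_mul]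
    rfl
  have hhom : ∀ mu : n.Partition, IsHom (p mu) n := fun mu =>
    isWeightedHomogeneous_monomial _ _ _ (deg_expo mu)
  refine ⟨fun mu => ∑ nu, ((weight (expo nu))⁻¹ * B nu mu) • p nu,
    fun mu => isHom_sum_smul _ _ _ hhom, fun lam mu => ?_⟩
  rw [map_sum, ← hAB, Matrix.mul_apply]
  refine Finset.sum_congr rfl fun nu _ => ?_
  rw [map_smul, hpairing, smul_eq_mul, Matrix.of_apply]
  have := weight_ne_zero (expo nu)
  field_simp

end Jack
end

noncomputable section

namespace Jack

open MvPolynomial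

variable {n : ℕ}

/-! ### Monomial symmetric functions -/

theorem qExp_eq_prod (d : ℕ →₀ ℕ) : qExp d = ((d.support.val.map d).map oneRow).prod := by
  rw [Multiset.map_map]
  rfl

/-- The monomial symmetric function `m_mu` as a polynomial in the power sums. -/
def mono (mu : n.Partition) : SymF := (exists_dual_basis n).choose mu

theorem isHom_mono (mu : n.Partition) : IsHom (mono mu) n :=
  (exists_dual_basis n).choose_spec.1 mu

theorem formL_q_mono (lam mu : n.Partition) :
    formL (q lam) (mono mu) = (1 : Matrix n.Partition n.Partition F) lam mu :=
  (exists_dual_basis n).choose_spec.2 lam mu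

/-- By `formL_qExp` each coefficient of the left side is a pairing with a product of one-row
functions, known by duality or zero for reasons of degree. -/
theorem realize_mono (mu : n.Partition) : realize (mono mu) = monomialSeries mu := by
  ext d
  have hpos : ∀ x ∈ d.support.val.map d, x ≠ 0 := by
    intro x hx
    obtain ⟨i, hi, rfl⟩ := Multiset.mem_map.1 hx
    exact Finsupp.mem_support_iff.1 hi
  have hms : MvPowerSeries.coeff d (monomialSeries mu)
      = if d.support.val.map d = mu.parts then 1 else 0 := rfl
  rw [← formL_qExp, hms, qExp_eq_prod]
  generalize d.support.val.map d = s at hpos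
  by_cases hs : s.sum = n
  · rw [← q_ofSums s hs, formL_q_mono, Matrix.one_apply]
    have hparts : (Nat.Partition.ofSums n s hs).parts = s := Multiset.filter_eq_self.2 hpos
    congr 1
    rw [Nat.Partition.ext_iff, hparts]
  · rw [formL_eq_zero_of_isHom (isHom_prod s) (isHom_mono mu) hs, if_neg]
    rintro rfl
    exact hs mu.parts_sum

theorem realize_injective : Function.Injective realize := by
  refine (injective_iff_map_eq_zero _).2 fun f hf => eq_zero_of_formL_monomial f fun d => ?_
  have hle : qSpan (deg d) ≤ LinearMap.ker (formL.flip f) := by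
    rw [qSpan, Submodule.span_le]
    rintro _ ⟨lam, rfl⟩
    have hq : q lam = qExp (Finsupp.onFinset (Finset.range (length lam)) (row lam) fun i hi =>
        Finset.mem_range.2 (not_le.1 fun h => hi (row_eq_zero lam h))) := by
      rw [qExp_eq Finsupp.support_onFinset_subset, q_eq_prod]
      rfl
    change formL (q lam) f = 0
    rw [hq, formL_qExp, hf, map_zero]
  exact hle (monomial_mem_qSpan d)

/-! ### Unitriangular matrices -/

theorem inv_unitriangular {ι K : Type*} [Fintype ι] [DecidableEq ι] [Field K] {le : ι → ι → Prop}
    (hrefl : ∀ i, le i i) (htrans : ∀ i j k, le i j → le j k → le i k) (h : ι → ℕ)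
    (hlt : ∀ i j, le i j → i ≠ j → h i < h j) {M : Matrix ι ι K} (hM : ∀ i j, M i j ≠ 0 → le i j)
    (hdiag : ∀ i, M i i = 1) :
    M * M⁻¹ = 1 ∧ (∀ i j, M⁻¹ i j ≠ 0 → le i j) ∧ ∀ i, M⁻¹ i i = 1 := by
  classical
  have hdet : M.det = 1 := by
    have hb : M.BlockTriangular h := by
      intro i j hij
      by_contra hc
      rcases eq_or_ne i j with rfl | hne
      · exact lt_irrefl _ hij
      · exact lt_asymm hij (hlt i j (hM i j hc) hne)
    rw [hb.det]
    refine Finset.prod_eq_one fun k _ => ?_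
    have : M.toSquareBlock h k = 1 := by
      ext ⟨i, hi⟩ ⟨j, hj⟩
      rw [Matrix.toSquareBlock_def, Matrix.of_apply, Matrix.one_apply]
      split_ifs with hij
      · rw [Subtype.mk.injEq] at hij
        subst hij
        exact hdiag i
      · by_contra hc
        have := hlt i j (hM i j hc) fun h => hij (Subtype.ext h)
        omega
    rw [this, Matrix.det_one]
  have hunit : IsUnit M.det := by rw [hdet]; exact isUnit_one
  have : Invertible M := Matrix.invertibleOfIsUnitDet M hunit
  have hmul : M * M⁻¹ = 1 := Matrix.mul_nonsing_inv M hunit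
  have htri : ∀ i j, M⁻¹ i j ≠ 0 → le i j := by
    intro i j hij
    by_contra hc
    -- Triangularity for a partial order is tested one row at a time: with `i` fixed, indices split
    -- into those above `i` and the rest. `M` is block triangular for this splitting, and its
    -- inverse inherits that.
    have hb : M.BlockTriangular fun k => decide (le i k) := by
      intro a b hab
      by_contra hne
      have hle := hM a b hne
      by_cases ha : le i a
      · simp [ha, htrans _ _ _ ha hle] at hab
      · simp only [decide_eq_false ha] at hab
        exact absurd hab (by cases decide (le i b) <;> decide)
    refine hij (Matrix.blockTriangular_inv_of_blockTriangular hb ?_)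
    simp [hc, hrefl i]
  refine ⟨hmul, htri, fun i => ?_⟩
  have h1 := congrFun (congrFun hmul i) i
  rw [Matrix.mul_apply, Matrix.one_apply_eq, Finset.sum_eq_single i, hdiag, one_mul] at h1
  · exact h1
  · intro j _ hji
    by_contra hc
    have h2 := hlt i j (hM i j (left_ne_zero_of_mul hc)) hji.symm
    have h3 := hlt j i (htri j i (right_ne_zero_of_mul hc)) hji
    omega
  · simp

/-! ### The Jack functions and their duals -/

open Classical in
/-- The matrix of the functions `jackQ lam` in terms of the functions `q mu`. -/
def jackMatrix (n : ℕ) : Matrix n.Partition n.Partition F :=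
  Matrix.of fun lam mu => ∑ rs ∈ moveSeqs lam with applySeq lam rs = mu, seqCoeff lam rs

theorem jackQ_eq_sum (lam : n.Partition) : jackQ lam = ∑ mu, jackMatrix n lam mu • q mu := by
  classical
  rw [jackQ, ← Finset.sum_fiberwise (moveSeqs lam) (applySeq lam)]
  refine Finset.sum_congr rfl fun mu _ => ?_
  rw [jackMatrix, Matrix.of_apply, Finset.sum_smul]
  refine Finset.sum_congr (by congr) fun rs hrs => ?_
  rw [(Finset.mem_filter.1 hrs).2]

theorem domLE_of_jackMatrix_ne_zero {lam mu : n.Partition} (h : jackMatrix n lam mu ≠ 0) :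
    DomLE lam mu := by
  obtain ⟨rs, hrs, _⟩ := Finset.exists_ne_zero_of_sum_ne_zero h
  obtain ⟨h1, rfl⟩ := Finset.mem_filter.1 hrs
  exact (mem_moveSeqs.1 h1).domLE

theorem jackMatrix_self (lam : n.Partition) : jackMatrix n lam lam = 1 := by
  rw [jackMatrix, Matrix.of_apply, Finset.sum_eq_single []]
  · exact seqCoeff_nil lam
  · intro rs hrs hne
    obtain ⟨h1, h2⟩ := Finset.mem_filter.1 hrs
    have := (mem_moveSeqs.1 h1).sumSq_lt hne
    rw [h2] at this
    exact absurd this (lt_irrefl _)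
  · intro h
    exact absurd (Finset.mem_filter.2
      ⟨mem_moveSeqs.2 (show IsMoveSeq lam [] from trivial), (rfl : applySeq lam [] = lam)⟩) h

theorem jackMatrix_inv (n : ℕ) : jackMatrix n * (jackMatrix n)⁻¹ = 1 ∧
    (∀ lam mu, (jackMatrix n)⁻¹ lam mu ≠ 0 → DomLE lam mu) ∧ ∀ lam, (jackMatrix n)⁻¹ lam lam = 1 :=
  inv_unitriangular DomLE.refl (fun _ _ _ => DomLE.trans) sumSq
    (fun _ _ h hne => DomLT.sumSq_lt ⟨h, hne⟩) (fun _ _ => domLE_of_jackMatrix_ne_zero)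
    jackMatrix_self

/-- The Jack function `P_lam`. -/
def jackP (lam : n.Partition) : SymF := ∑ mu, (jackMatrix n)⁻¹ mu lam • mono mu

theorem isHom_jackP (lam : n.Partition) : IsHom (jackP lam) n := isHom_sum_smul _ _ _ isHom_mono

theorem isHom_jackQ (lam : n.Partition) : IsHom (jackQ lam) n :=
  isHom_sum_smul _ _ _ fun _ => isHom_q _

theorem formL_sum_q_mono (c : n.Partition → F) (mu : n.Partition) :
    formL (∑ lam, c lam • q lam) (mono mu) = c mu := by
  rw [map_sum, LinearMap.sum_apply, Finset.sum_eq_single mu]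
  · rw [map_smul, LinearMap.smul_apply, formL_q_mono, Matrix.one_apply_eq, smul_eq_mul, mul_one]
  · intro lam _ hne
    rw [map_smul, LinearMap.smul_apply, formL_q_mono, Matrix.one_apply_ne hne, smul_zero]
  · simp

theorem formL_jackQ_jackP (lam mu : n.Partition) :
    formL (jackQ lam) (jackP mu) = (1 : Matrix n.Partition n.Partition F) lam mu := by
  rw [jackP, map_sum, jackQ_eq_sum, ← (jackMatrix_inv n).1, Matrix.mul_apply]
  refine Finset.sum_congr rfl fun nu _ => ?_
  rw [map_smul, formL_sum_q_mono, smul_eq_mul, mul_comm]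

theorem q_eq_sum_jackQ (lam : n.Partition) :
    q lam = ∑ mu, (jackMatrix n)⁻¹ lam mu • jackQ mu := by
  have h := mul_eq_one_comm.1 (jackMatrix_inv n).1
  simp only [jackQ_eq_sum, Finset.smul_sum, smul_smul]
  rw [Finset.sum_comm]
  simp only [← Finset.sum_smul, ← Matrix.mul_apply, h]
  rw [Finset.sum_eq_single lam]
  · rw [Matrix.one_apply_eq, one_smul]
  · intro mu _ hne
    rw [Matrix.one_apply_ne hne.symm, zero_smul]
  · simp

theorem isHom_ext_jackQ {f : SymF} (hf : IsHom f n)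
    (h : ∀ lam : n.Partition, formL (jackQ lam) f = 0) : f = 0 := by
  refine isHom_ext hf fun lam => ?_
  rw [q_eq_sum_jackQ, map_sum, LinearMap.sum_apply]
  refine Finset.sum_eq_zero fun mu _ => ?_
  rw [map_smul, LinearMap.smul_apply, h, smul_zero]

theorem isHom_eq_sum_jackP {f : SymF} (hf : IsHom f n) :
    f = ∑ lam : n.Partition, formL (jackQ lam) f • jackP lam := by
  rw [← sub_eq_zero]
  refine isHom_ext_jackQ (hf.sub (isHom_sum_smul _ _ _ isHom_jackP)) fun mu => ?_
  rw [map_sub, map_sum, sub_eq_zero, Finset.sum_eq_single mu]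
  · rw [map_smul, formL_jackQ_jackP, Matrix.one_apply_eq, smul_eq_mul, mul_one]
  · intro lam _ hne
    rw [map_smul, formL_jackQ_jackP, Matrix.one_apply_ne hne.symm, smul_zero]
  · simp

theorem mono_eq_sum_jackP (mu : n.Partition) :
    mono mu = ∑ lam : n.Partition, jackMatrix n lam mu • jackP lam := by
  refine (isHom_eq_sum_jackP (isHom_mono mu)).trans (Finset.sum_congr rfl fun lam _ => ?_)
  rw [jackQ_eq_sum, formL_sum_q_mono]

theorem eq_zero_of_formL_jackP {f : SymF}
    (h : ∀ (n : ℕ) (lam : n.Partition), formL f (jackP lam) = 0) : f = 0 := by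
  refine eq_zero_of_formL_monomial f fun d => ?_
  rw [isHom_eq_sum_jackP (isWeightedHomogeneous_monomial _ d (1 : F) rfl), map_sum,
    LinearMap.sum_apply]
  refine Finset.sum_eq_zero fun lam _ => ?_
  rw [map_smul, LinearMap.smul_apply, formL_comm (jackP lam) f, h, smul_zero]

/-! ### Orthogonality and uniqueness -/

theorem jackP_eq_sum_jackQ (lam : n.Partition) :
    jackP lam = ∑ mu : n.Partition, formL (jackP mu) (jackP lam) • jackQ mu := by
  rw [← sub_eq_zero]
  refine eq_zero_of_formL_jackP fun m mu => ?_
  rcases eq_or_ne n m with rfl | hnm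
  · rw [map_sub, LinearMap.sub_apply, sub_eq_zero, map_sum, LinearMap.sum_apply,
      Finset.sum_eq_single mu]
    · rw [map_smul, LinearMap.smul_apply, formL_jackQ_jackP, Matrix.one_apply_eq, smul_eq_mul,
        mul_one, formL_comm]
    · intro nu _ hne
      rw [map_smul, LinearMap.smul_apply, formL_jackQ_jackP, Matrix.one_apply_ne hne, smul_zero]
    · simp
  · exact formL_eq_zero_of_isHom ((isHom_jackP lam).sub (isHom_sum_smul _ _ _ isHom_jackQ))
      (isHom_jackP mu) hnm

/-- In the expansion of `jackP lam` in the eigenvectors `jackQ nu`, pairing with `jackP mu` isolates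
`nu = mu`, hence the eigenvalue of `mu`. -/
theorem formL_lapF_jackP (lam mu : n.Partition) : formL (lapF n (jackP lam)) (jackP mu)
    = (ePrime mu + n / 2) * formL (jackP mu) (jackP lam) := by
  conv_lhs => rw [jackP_eq_sum_jackQ lam]
  rw [map_sum, map_sum, LinearMap.sum_apply, Finset.sum_eq_single mu]
  · rw [map_smul, lapF_jackQ, map_smul, map_smul, LinearMap.smul_apply, LinearMap.smul_apply,
      formL_jackQ_jackP, Matrix.one_apply_eq, smul_eq_mul, smul_eq_mul]
    ring
  · intro nu _ hne
    rw [map_smul, lapF_jackQ, map_smul, map_smul, LinearMap.smul_apply, LinearMap.smul_apply,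
      formL_jackQ_jackP, Matrix.one_apply_ne hne, smul_zero, smul_zero]
  · simp

/-- By self-adjointness the pairing is multiplied by either eigenvalue with the same result.
Comparability ensures that they differ: the incomparable `(4,1,1)` and `(3,3)` have the same `e'`.
-/
theorem formL_jackP_eq_zero {lam mu : n.Partition} (h : DomLT mu lam) :
    formL (jackP lam) (jackP mu) = 0 := by
  have h1 := formL_lapF_jackP lam mu
  have h2 := formL_lapF_jackP mu lam
  rw [formL_lapF, formL_comm, h1, formL_comm (jackP lam)] at h2
  have hne : ePrime mu ≠ ePrime lam := fun he => h.sumSq_lt.ne (sumSq_eq_of_ePrime_eq he)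
  rw [formL_comm]
  by_contra hc
  exact hne (add_right_cancel (mul_right_cancel₀ hc h2))

theorem isJackFamily_jackP : IsJackFamily fun x => jackP x.2 := by
  refine ⟨fun n lam => ⟨fun mu => (jackMatrix n)⁻¹ mu lam, (jackMatrix_inv n).2.2 lam,
    fun mu => (jackMatrix_inv n).2.1 mu lam, ?_⟩, fun n lam mu h => ?_⟩
  · simp only [jackP, map_sum, map_smul, realize_mono]
  · rw [form_eq]
    exact formL_jackP_eq_zero h

theorem isDualFamily_jackQ : IsDualFamily (fun x => jackP x.2) fun x => jackQ x.2 := by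
  rintro ⟨n, lam⟩ ⟨m, mu⟩
  rw [form_eq]
  rcases eq_or_ne n m with rfl | hnm
  · rw [formL_jackQ_jackP, Matrix.one_apply]
    congr 1
    simp
  · rw [if_neg (by simp [hnm])]
    exact formL_eq_zero_of_isHom (isHom_jackQ lam) (isHom_jackP mu) hnm

/-- The difference from `jackP lam` lies in the span of the `jackP nu` with `nu < lam`. By induction
these are also members of `P`, so the difference is orthogonal to them and hence to itself. -/
theorem IsJackFamily.eq_jackP {P : Ptn → SymF} (hP : IsJackFamily P) : P = fun x => jackP x.2 := by
  ext1 ⟨n, lam⟩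
  induction hk : sumSq lam using Nat.strong_induction_on generalizing lam with
  | _ k ih =>
    obtain ⟨c, hc1, hc2, hc3⟩ := hP.1 n lam
    have hexp : P ⟨n, lam⟩ = ∑ mu, c mu • mono mu := by
      apply realize_injective
      rw [hc3, map_sum]
      simp only [map_smul, realize_mono]
    have hdiff : P ⟨n, lam⟩ - jackP lam
        = ∑ mu : n.Partition, (c mu - (jackMatrix n)⁻¹ mu lam) • mono mu := by
      rw [hexp, jackP, ← Finset.sum_sub_distrib]
      exact Finset.sum_congr rfl fun mu _ => (sub_smul _ _ _).symm
    rw [← sub_eq_zero]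
    apply eq_zero_of_formL_self
    -- Only one copy of the difference is expanded; the other is kept for the orthogonality
    -- relations.
    conv_lhs => arg 2; rw [hdiff]
    rw [map_sum]
    refine Finset.sum_eq_zero fun mu _ => ?_
    rw [map_smul]
    by_cases hmu : DomLT mu lam
    · rw [mono_eq_sum_jackP, map_sum, Finset.sum_eq_zero, smul_zero]
      intro nu _
      rw [map_smul]
      by_cases hnu : DomLE nu mu
      · have hlt : DomLT nu lam := by
          refine ⟨hnu.trans hmu.1, ?_⟩
          rintro rfl
          exact hmu.2 (DomLE.antisymm hmu.1 hnu)
        have h1 := hP.2 n lam nu hlt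
        rw [ih _ (hk ▸ hlt.sumSq_lt) nu rfl, form_eq] at h1
        rw [map_sub, LinearMap.sub_apply, h1, formL_jackP_eq_zero hlt, sub_zero, smul_zero]
      · rw [not_imp_comm.1 domLE_of_jackMatrix_ne_zero hnu, zero_smul]
    · have : c mu - (jackMatrix n)⁻¹ mu lam = 0 := by
        rcases eq_or_ne mu lam with rfl | hne
        · rw [hc1, (jackMatrix_inv n).2.2, sub_self]
        · have hle : ¬ DomLE mu lam := fun h => hmu ⟨h, hne⟩
          rw [not_imp_comm.1 (hc2 mu) hle, not_imp_comm.1 ((jackMatrix_inv n).2.1 mu lam) hle,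
            sub_self]
      rw [this, zero_smul]

theorem IsDualFamily.eq_jackQ {Q : Ptn → SymF} (hQ : IsDualFamily (fun x => jackP x.2) Q) :
    Q = fun x => jackQ x.2 := by
  ext1 lam
  rw [← sub_eq_zero]
  refine eq_zero_of_formL_jackP fun m mu => ?_
  have h1 := hQ lam ⟨m, mu⟩
  have h2 := isDualFamily_jackQ lam ⟨m, mu⟩
  rw [form_eq] at h1 h2
  rw [map_sub, LinearMap.sub_apply, h1, h2, sub_self]

end Jack
end

theorem corollary5p9 :
    (∃! PQ : (Jack.Ptn → Jack.SymF) × (Jack.Ptn → Jack.SymF),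
      Jack.IsJackFamily PQ.1 ∧ Jack.IsDualFamily PQ.1 PQ.2) ∧
    ∀ P Q : Jack.Ptn → Jack.SymF, Jack.IsJackFamily P → Jack.IsDualFamily P Q →
      ∀ (n : ℕ) (lam : n.Partition),
        {rs : List Jack.Move | Jack.IsMoveSeq lam rs}.Finite ∧
        (∀ rs : List Jack.Move, Jack.IsMoveSeq lam rs → rs ≠ [] →
          Jack.ePrime lam ≠ Jack.ePrime (Jack.applySeq lam rs)) ∧
        Q ⟨n, lam⟩ = ∑ᶠ rs ∈ {rs : List Jack.Move | Jack.IsMoveSeq lam rs},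
          Jack.seqCoeff lam rs • Jack.q (Jack.applySeq lam rs) := by
  refine ⟨⟨(fun x => Jack.jackP x.2, fun x => Jack.jackQ x.2),
    ⟨Jack.isJackFamily_jackP, Jack.isDualFamily_jackQ⟩, ?_⟩, ?_⟩
  · rintro ⟨P, Q⟩ ⟨hP, hQ⟩
    obtain rfl : P = _ := hP.eq_jackP
    obtain rfl : Q = _ := hQ.eq_jackQ
    rfl
  · intro P Q hP hQ n lam
    obtain rfl := hP.eq_jackP
    obtain rfl := hQ.eq_jackQ
    refine ⟨Jack.finite_isMoveSeq lam, fun rs => Jack.ePrime_ne, ?_⟩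
    rw [finsum_mem_eq_finite_toFinset_sum _ (Jack.finite_isMoveSeq lam)]
    rfl
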